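/- **Setting.** There are $K\ge 1$ devices with differentiable losses $F_1,\dots,F_K:\mathbb R^d\to\mathbb R$, and $F_g=\frac1K\sum_{k}F_k$ is the global loss. For constants $L,\mu>0$ and $\varrho$, every $k$ and all $x,y$: (smoothness) $\|\nabla F_k(x)-\nabla F_k(y)\|\le L\|x-y\|$; (strong convexity) $F_k(x)\ge F_k(y)+\langle\nabla F_k(y),x-y\rangle+\frac\mu2\|x-y\|^2$; (bounded variance) the stochastic gradient $\nabla F_k(x;\xi)$ at a random mini-batch $\xi$ satisfies $\mathbb E\,\nabla F_k(x;\xi)=\nabla F_k(x)$ and $\mathbb E\|\nabla F_k(x;\xi)-\nabla F_k(x)\|^2\le\varrho^2$. Let $w_k^*,w_g^*$ be the minimizers of $F_k,F_g$, let $F_k^*=F_k(w_k^*)$, $\zeta_k=\sup_w\|\nabla F_g(w)-\nabla F_k(w)\|^2$ (assumed finite), $\zeta=\sum_k\zeta_k$, $\Delta_k=\|w_k^*-w_g^*\|^2$ and $\kappa=L/\mu$. **Algorithm** (adaptive personalized federated learning with full participation). Let $G\ge1$ be the number of local iterations between two synchronizations, $a=\max\{128\kappa,G\}$, $\varepsilon_t=\frac{16}{\mu(t+a)}$.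 Device $k$ keeps a copy $u_{k,t}$ of the global model, with $u_{k,0}=w_{g,0}$ for all $k$, and a local model $w_{k,t}$; the initial models are square integrable and independent of the mini-batches $\xi_{k,t}$, which are independent over all $k,t$, with law depending only on $k$. In iteration $t$, $$u_{k,t+1}=u_{k,t}-\varepsilon_t\nabla F_k(u_{k,t};\xi_{k,t}),\qquad w_{k,t+1}=w_{k,t}-\varepsilon_t\psi_k\nabla F_k\big(\psi_kw_{k,t}+(1-\psi_k)u_{k,t};\xi_{k,t}\big),$$ after which, if $G\mid t+1$, all copies $u_{k,t+1}$ are replaced by their average. The global model is $w_{g,t}=\frac1K\sum_ku_{k,t}$, and the personalized model is $\hat w_{k,t}=\psi_kw_{k,t}+(1-\psi_k)w_{g,t}$. **Theorem 2.** Suppose that the mixing weights, fixed in time, satisfy $\max\{1-\frac1{4\sqrt6\,\kappa},\,1-\frac1{4\sqrt6\,\kappa\sqrt\mu}\}\le\psi_k\le1$ for all $k$. There are an absolute constant $C$ and a constant $c_\kappa$ depending only on $\kappa$ such that, with $R_k=\mathbb E\|\hat w_{k,0}-w_k^*\|^2+\mathbb E\|w_{g,0}-w_g^*\|^2$, for every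 device $k$ and every $T\ge1$ the random variable $F_k(\hat w_{k,T})$ is integrable and $$\begin{aligned}\mathbb E[F_k(\hat w_{k,T})]-F_k^*\le{}&c_\kappa a^3R_k\frac{\mu}{T^3}+\psi_k^2\,c_\kappa\frac{\varrho^2}{\mu T}\\&+(1-\psi_k)^2\Big\{C\Big(\frac{\zeta_k}\mu+\frac{\kappa L\Delta_k}2\Big)+C R_k\frac{\kappa L\ln T}{T^3}+C\frac{\kappa^2\varrho^2}{\mu KT}\Big\}\\&+(1-\psi_k)^2\,C\Big(\frac{\kappa^2G\big(\varrho^2+G(\zeta_k+\frac\zeta K)\big)}{\mu T^2}+\frac{\kappa^4G\big(\varrho^2+2G\frac\zeta K\big)}{\mu T^2}\Big).\end{aligned}$$ Here $C$ and $c_\kappa$ do not depend on $d,K,G,T$, the weights, the losses, the stochastic gradients or the initial models. -/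

import Mathlib

open MeasureTheory ProbabilityTheory

universe u v

/-- The parameter space of the models. -/
abbrev Model (d : ℕ) : Type := EuclideanSpace ℝ (Fin d)

/-- `F` is differentiable and its gradient is `L`-Lipschitz. -/
def SmoothWith {d : ℕ} (L : ℝ) (F : Model d → ℝ) : Prop :=
  Differentiable ℝ F ∧ ∀ x y : Model d, ‖gradient F x - gradient F y‖ ≤ L * ‖x - y‖

/-- First-order form of `μ`-strong convexity. -/
def StronglyConvexWith {d : ℕ} (μ : ℝ) (F : Model d → ℝ) : Prop :=
  ∀ x y : Model d, F y + inner ℝ (gradient F y) (x - y) + μ / 2 * ‖x - y‖ ^ 2 ≤ F x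

/-- `g w ξ` is an unbiased stochastic gradient of `F` at `w`, computed at the mini-batch `ξ` drawn
from `P`, and its variance is at most `ϱ ^ 2` at every `w`. -/
structure BoundedVarianceGradient {d : ℕ} {S : Type v} [MeasurableSpace S] (P : Measure S)
    (ϱ : ℝ) (F : Model d → ℝ) (g : Model d → S → Model d) : Prop where
  measurable : Measurable (fun p : Model d × S => g p.1 p.2)
  integrable : ∀ w, Integrable (g w) P
  unbiased : ∀ w, ∫ s, g w s ∂P = gradient F w
  integrable_sq : ∀ w, Integrable (fun s => ‖g w s - gradient F w‖ ^ 2) P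
  variance_le : ∀ w, ∫ s, ‖g w s - gradient F w‖ ^ 2 ∂P ≤ ϱ ^ 2

section Federated

variable {d K : ℕ}

/-- The average of the models held by the `K` devices. -/
noncomputable def averageModel (w : Fin K → Model d) : Model d :=
  (K : ℝ)⁻¹ • ∑ k, w k

/-- The global loss: the average of the losses of the `K` devices. -/
noncomputable def globalLoss (F : Fin K → Model d → ℝ) (w : Model d) : ℝ :=
  (K : ℝ)⁻¹ * ∑ k, F k w

/-- The squared distance of the global and the local gradient at `w`. -/
noncomputable def gradientGapSq (F : Fin K → Model d → ℝ) (k : Fin K) (w : Model d) : ℝ :=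
  ‖gradient (globalLoss F) w - gradient (F k) w‖ ^ 2

/-- Gradient diversity `ζ_k` (meaningful when the supremum is finite). -/
noncomputable def gradientDiversity (F : Fin K → Model d → ℝ) (k : Fin K) : ℝ :=
  ⨆ w, gradientGapSq F k w

/-- The learning rate `16 / (μ (t + a))`. -/
noncomputable def learningRate (μ a : ℝ) (t : ℕ) : ℝ :=
  16 / (μ * ((t : ℝ) + a))

variable {S : Fin K → Type v}

/-- The devices' copies of the global model after `t` iterations: every device runs stochastic
gradient descent on its own copy, and after every `G` iterations all copies are replaced by their
average. All copies start at `w₀`. -/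
noncomputable def globalCopies (ε : ℕ → ℝ) (G : ℕ) (g : ∀ k, Model d → S k → Model d)
    (ξ : ∀ k, ℕ → S k) (w₀ : Model d) : ℕ → Fin K → Model d
  | 0 => fun _ => w₀
  | t + 1 =>
    let y : Fin K → Model d := fun k =>
      globalCopies ε G g ξ w₀ t k - ε t • g k (globalCopies ε G g ξ w₀ t k) (ξ k t)
    if G ∣ t + 1 then fun _ => averageModel y else y

/-- The global model `w_{g,t}`: the average of the devices' copies (at a synchronization
time it coincides with every copy). -/
noncomputable def globalModel (ε : ℕ → ℝ) (G : ℕ) (g : ∀ k, Model d → S k → Model d)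
    (ξ : ∀ k, ℕ → S k) (w₀ : Model d) (t : ℕ) : Model d :=
  averageModel (globalCopies ε G g ξ w₀ t)

/-- The local models `w_{k,t}`: device `k` takes a stochastic gradient step for the function
`w ↦ F_k (ψ_k w + (1 - ψ_k) u)`, where `u` is its current copy of the global model, with the same
mini-batch as in the update of that copy. -/
noncomputable def localModel (ε : ℕ → ℝ) (G : ℕ) (g : ∀ k, Model d → S k → Model d)
    (ψ : Fin K → ℝ) (ξ : ∀ k, ℕ → S k) (w₀ : Model d) (v₀ : Fin K → Model d) :
    ℕ → Fin K → Model d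
  | 0 => v₀
  | t + 1 => fun k =>
    localModel ε G g ψ ξ w₀ v₀ t k - ε t • ψ k • g k
      (ψ k • localModel ε G g ψ ξ w₀ v₀ t k + (1 - ψ k) • globalCopies ε G g ξ w₀ t k) (ξ k t)

/-- The personalized model `ψ_k w_{k,t} + (1 - ψ_k) w_{g,t}`. -/
noncomputable def personalizedModel (ε : ℕ → ℝ) (G : ℕ) (g : ∀ k, Model d → S k → Model d)
    (ψ : Fin K → ℝ) (ξ : ∀ k, ℕ → S k) (w₀ : Model d) (v₀ : Fin K → Model d)
    (t : ℕ) (k : Fin K) : Model d :=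
  ψ k • localModel ε G g ψ ξ w₀ v₀ t k + (1 - ψ k) • globalModel ε G g ξ w₀ t

end Federated

/-! ### Smooth and strongly convex functions. -/

section Convex

variable {d : ℕ} {L μ : ℝ} {F : Model d → ℝ}

/-! Write `v` for the personalized model of device `k`, `ū` for the average of the copies and `θ = 1
- ψ_k`. In one iteration `v` moves along `ψ_k² ∇F_k(x) + θ b`, where `b` is the average of the local
gradients at the copies and `x` differs from `v` by `θ` times the drift of copy `k` from `ū`. The
first part contracts `v` towards `w_k^*`. The second costs a multiple of `(ε/μ) θ² ‖b‖²`, and `‖b‖²`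
is controlled by the drift and by the optimality gap of the global loss at `ū`. That gap is exactly
what the descent of `ū` towards `w_g^*` leaves over. Hence the Lyapunov function `E‖v - w_k^*‖² + 46
κ θ² E‖ū - w_g^*‖²` contracts by `1 - (5/16) μ ε_t = 1 - 5/(t + a)`, up to noise of order `ε_t²` and
drift terms carrying `θ²` (`coupled_step_le`, `NoisyRun.coupled_error_succ_le`).

The drift is reset at each synchronization and grows for at most `G` iterations, so it is of order
`ε_t²`. Its mean over devices is bounded first, and this bound then feeds the one for a single
device (`NoisyRun.mean_copyDrift_le`, `NoisyRun.copyDrift_le`). Solving the recursion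
(`le_of_harmonic_recursion`) gives terms in `1/T³`, `1/T` and `1/T²`; smoothness at the minimizer
converts squared distance into loss. This argument produces neither a heterogeneity bias nor a
logarithm: the first brace of the claimed bound is only used as nonnegative slack.

Randomness enters through one fact: fresh gradient noise is orthogonal to every square-integrable
function of the current state (`BoundedVarianceGradient.centeredGiven`), so it only adds its second
moment. -/

theorem SmoothWith.le_quadratic (hF : SmoothWith L F) (x y : Model d) :
    F y ≤ F x + inner ℝ (gradient F x) (y - x) + L / 2 * ‖y - x‖ ^ 2 := by
  set v := y - x with hv
  -- The Lipschitz gradient makes `φ` nonincreasing on `[0, 1]`; the claim is `φ 1 ≤ φ 0`.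
  let φ : ℝ → ℝ := fun t =>
    F (x + t • v) - t * inner ℝ (gradient F x) v - L / 2 * ‖v‖ ^ 2 * t ^ 2
  have hline : ∀ t : ℝ, HasDerivAt (fun t : ℝ => F (x + t • v))
      (inner ℝ (gradient F (x + t • v)) v) t := by
    intro t
    have h1 : HasDerivAt (fun t : ℝ => x + t • v) v t := by
      simpa using ((hasDerivAt_id t).smul_const v).const_add x
    have h2 := (hF.1 (x + t • v)).hasGradientAt.hasFDerivAt.comp_hasDerivAt t h1
    exact h2.congr_deriv (by simp)
  have hφ : ∀ t : ℝ, HasDerivAt φ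
      (inner ℝ (gradient F (x + t • v)) v - inner ℝ (gradient F x) v - L * ‖v‖ ^ 2 * t) t := by
    intro t
    have h := ((hline t).sub ((hasDerivAt_id t).mul_const (inner ℝ (gradient F x) v))).sub
      (((hasDerivAt_id t).pow 2).const_mul (L / 2 * ‖v‖ ^ 2))
    refine h.congr_deriv ?_
    simp
    ring
  have hanti : AntitoneOn φ (Set.Icc 0 1) := by
    refine antitoneOn_of_deriv_nonpos (convex_Icc 0 1)
      (fun t _ => (hφ t).continuousAt.continuousWithinAt)
      (fun t _ => (hφ t).differentiableAt.differentiableWithinAt) ?_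
    intro t ht
    rw [interior_Icc] at ht
    rw [(hφ t).deriv, ← inner_sub_left]
    have h1 := real_inner_le_norm (gradient F (x + t • v) - gradient F x) v
    have h2 := hF.2 (x + t • v) x
    rw [add_sub_cancel_left, norm_smul, Real.norm_of_nonneg ht.1.le] at h2
    nlinarith [norm_nonneg v]
  have := hanti (Set.left_mem_Icc.2 zero_le_one) (Set.right_mem_Icc.2 zero_le_one) zero_le_one
  simp only [φ, one_smul, zero_smul, add_zero, one_mul, zero_mul, one_pow, mul_one, sub_zero,
    ne_eq, OfNat.ofNat_ne_zero, not_false_eq_true, zero_pow, mul_zero] at this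
  rw [hv, add_sub_cancel, ← hv] at this
  linarith

theorem SmoothWith.continuous_gradient (hF : SmoothWith L F) : Continuous (gradient F) := by
  have : LipschitzWith L.toNNReal (gradient F) :=
    LipschitzWith.of_dist_le' fun x y => by simpa [dist_eq_norm] using hF.2 x y
  exact this.continuous

/-- A convex function with `L`-Lipschitz gradient lies quadratically above its tangents, measured
by the gradient. -/
theorem SmoothWith.sq_norm_gradient_sub_le (hL : 0 < L) (hF : SmoothWith L F)
    (hconv : ∀ x y : Model d, F y + inner ℝ (gradient F y) (x - y) ≤ F x) (x y : Model d) :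
    ‖gradient F x - gradient F y‖ ^ 2 ≤
      2 * L * (F x - F y - inner ℝ (gradient F y) (x - y)) := by
  set b := gradient F x - gradient F y with hb
  -- The test point minimizes the quadratic upper model at `x` of `F` minus its linear part at `y`.
  -- Convexity bounds `F` there from below, smoothness from above.
  have h1 := hconv (x - L⁻¹ • b) y
  have h2 := hF.le_quadratic x (x - L⁻¹ • b)
  have e1 : x - L⁻¹ • b - y = (x - y) - L⁻¹ • b := by abel
  have e2 : x - L⁻¹ • b - x = -(L⁻¹ • b) := by abel
  rw [e1, inner_sub_right, inner_smul_right] at h1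
  rw [e2, inner_neg_right, inner_smul_right, norm_neg, norm_smul, mul_pow,
    Real.norm_of_nonneg (inv_pos.2 hL).le] at h2
  have h3 : inner ℝ (gradient F x) b - inner ℝ (gradient F y) b = ‖b‖ ^ 2 := by
    rw [← inner_sub_left, ← hb, real_inner_self_eq_norm_sq]
  have h4 : L / 2 * (L⁻¹ ^ 2 * ‖b‖ ^ 2) = L⁻¹ * ‖b‖ ^ 2 / 2 := by field_simp
  have h5 : L⁻¹ * ‖b‖ ^ 2 ≤ 2 * (F x - F y - inner ℝ (gradient F y) (x - y)) := by
    have h6 : L⁻¹ * inner ℝ (gradient F x) b - L⁻¹ * inner ℝ (gradient F y) b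
      = L⁻¹ * ‖b‖ ^ 2 := by rw [← mul_sub, h3]
    linarith
  have := mul_le_mul_of_nonneg_left h5 hL.le
  rw [← mul_assoc, mul_inv_cancel₀ hL.ne', one_mul] at this
  linarith

theorem StronglyConvexWith.le (hμ : 0 ≤ μ) (hF : StronglyConvexWith μ F) (x y : Model d) :
    F y + inner ℝ (gradient F y) (x - y) ≤ F x := by
  have := hF x y
  have : 0 ≤ μ / 2 * ‖x - y‖ ^ 2 := by positivity
  linarith

/-- Gradient steps of length at most `2 / L` are nonexpansive. -/
theorem SmoothWith.norm_gradient_step_sub_le (hL : 0 < L) (hF : SmoothWith L F)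
    (hconv : ∀ x y : Model d, F y + inner ℝ (gradient F y) (x - y) ≤ F x)
    {ε : ℝ} (hε : 0 ≤ ε) (hεL : ε * L ≤ 2) (x y : Model d) :
    ‖x - y - ε • (gradient F x - gradient F y)‖ ≤ ‖x - y‖ := by
  have h1 := hF.sq_norm_gradient_sub_le hL hconv x y
  have h2 := hF.sq_norm_gradient_sub_le hL hconv y x
  rw [norm_sub_rev] at h2
  -- Cocoercivity: the two gap inequalities are added with `x` and `y` exchanged.
  have h3 : ‖gradient F x - gradient F y‖ ^ 2
      ≤ L * inner ℝ (x - y) (gradient F x - gradient F y) := by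
    have : inner ℝ (x - y) (gradient F x - gradient F y)
        = - inner ℝ (gradient F x) (y - x) - inner ℝ (gradient F y) (x - y) := by
      rw [real_inner_comm, inner_sub_left, ← neg_sub x y, inner_neg_right]
      ring
    rw [this]
    linarith
  refine le_of_sq_le_sq ?_ (norm_nonneg _)
  rw [norm_sub_sq_real, inner_smul_right, norm_smul, mul_pow, Real.norm_of_nonneg hε]
  have h4 : 0 ≤ inner ℝ (x - y) (gradient F x - gradient F y) := by
    by_contra! h
    nlinarith [sq_nonneg ‖gradient F x - gradient F y‖]
  nlinarith [mul_le_mul_of_nonneg_left h3 (sq_nonneg ε),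
    mul_le_mul_of_nonneg_right hεL (mul_nonneg hε h4)]

theorem gradient_eq_zero_of_isMinOn {x : Model d} (h : IsMinOn F Set.univ x) :
    gradient F x = 0 := by
  have := (h.isLocalMin Filter.univ_mem).fderiv_eq_zero
  simp [gradient, this]

theorem SmoothWith.sq_norm_gradient_le (hL : 0 < L) (hF : SmoothWith L F)
    (hconv : ∀ x y : Model d, F y + inner ℝ (gradient F y) (x - y) ≤ F x) {x₀ : Model d}
    (h₀ : gradient F x₀ = 0) (x : Model d) : ‖gradient F x‖ ^ 2 ≤ 2 * L * (F x - F x₀) := by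
  simpa [h₀] using hF.sq_norm_gradient_sub_le hL hconv x x₀

/-- At a nonzero point the lower and upper quadratics based at `0` enclose the same value. Dimension
zero has no such point. -/
theorem StronglyConvexWith.le_of_smoothWith (hsm : SmoothWith L F) (hF : StronglyConvexWith μ F)
    [Nontrivial (Model d)] : μ ≤ L := by
  obtain ⟨x, hx⟩ := exists_ne (0 : Model d)
  have h1 := hF x 0
  have h2 := hsm.le_quadratic 0 x
  have : 0 < ‖x - 0‖ ^ 2 := by rw [sub_zero]; positivity
  nlinarith

end Convex

/-! ### Averages over devices and the global loss. -/

section Average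

variable {d K : ℕ}

/-- Bias-variance decomposition: the cross terms cancel because deviations from the average sum to
zero. -/
theorem sum_norm_sub_sq_eq [NeZero K] (z : Fin K → Model d) (b : Model d) :
    ∑ j, ‖z j - b‖ ^ 2 = ∑ j, ‖z j - averageModel z‖ ^ 2 + K * ‖averageModel z - b‖ ^ 2 := by
  have h0 : ∑ j, (z j - averageModel z) = 0 := by
    have : (K : ℝ) ≠ 0 := Nat.cast_ne_zero.2 (NeZero.ne K)
    rw [Finset.sum_sub_distrib, averageModel]
    simp [← Nat.cast_smul_eq_nsmul ℝ, smul_smul, this]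
  have h1 : ∀ j, ‖z j - b‖ ^ 2 = ‖z j - averageModel z‖ ^ 2
      + 2 * inner ℝ (z j - averageModel z) (averageModel z - b) + ‖averageModel z - b‖ ^ 2 := by
    intro j
    rw [← norm_add_sq_real, sub_add_sub_cancel]
  simp_rw [h1, Finset.sum_add_distrib, ← Finset.mul_sum, ← sum_inner, h0]
  simp

/-- The average minimizes the mean squared distance. -/
theorem mean_norm_sub_averageModel_sq_le [NeZero K] (z : Fin K → Model d) (b : Model d) :
    (K : ℝ)⁻¹ * ∑ j, ‖z j - averageModel z‖ ^ 2 ≤ (K : ℝ)⁻¹ * ∑ j, ‖z j - b‖ ^ 2 := by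
  rw [sum_norm_sub_sq_eq z b]
  gcongr
  exact le_add_of_nonneg_right (by positivity)

theorem norm_averageModel_sq_le [NeZero K] (z : Fin K → Model d) :
    ‖averageModel z‖ ^ 2 ≤ (K : ℝ)⁻¹ * ∑ j, ‖z j‖ ^ 2 := by
  have hK : (0 : ℝ) < K := Nat.cast_pos.2 (NeZero.pos K)
  have := sum_norm_sub_sq_eq z 0
  simp only [sub_zero] at this
  rw [this, mul_add, inv_mul_cancel_left₀ hK.ne']
  exact le_add_of_nonneg_left (by positivity)

theorem averageModel_sub (z z' : Fin K → Model d) :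
    averageModel (fun j => z j - z' j) = averageModel z - averageModel z' := by
  simp [averageModel, smul_sub]

theorem averageModel_add (z z' : Fin K → Model d) :
    averageModel (fun j => z j + z' j) = averageModel z + averageModel z' := by
  simp [averageModel, Finset.sum_add_distrib]

theorem averageModel_smul (r : ℝ) (z : Fin K → Model d) :
    averageModel (fun j => r • z j) = r • averageModel z := by
  simp only [averageModel, ← Finset.smul_sum]
  rw [smul_comm]

theorem averageModel_const [NeZero K] (w : Model d) :
    averageModel (fun _ : Fin K => w) = w := by
  have : (K : ℝ) ≠ 0 := Nat.cast_ne_zero.2 (NeZero.ne K)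
  simp [averageModel, ← Nat.cast_smul_eq_nsmul ℝ, smul_smul, this]

@[fun_prop]
theorem measurable_averageModel : Measurable (averageModel : (Fin K → Model d) → Model d) := by
  unfold averageModel
  fun_prop

theorem gradient_globalLoss {F : Fin K → Model d → ℝ} (hF : ∀ k, Differentiable ℝ (F k))
    (w : Model d) : gradient (globalLoss F) w = averageModel fun k => gradient (F k) w := by
  refine HasGradientAt.gradient ?_
  rw [hasGradientAt_iff_hasFDerivAt]
  have h := (HasFDerivAt.fun_sum (u := Finset.univ)
    fun k _ => ((hF k) w).hasGradientAt.hasFDerivAt).const_mul (K : ℝ)⁻¹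
  refine h.congr_fderiv ?_
  ext x
  simp [averageModel]

theorem SmoothWith.globalLoss [NeZero K] {L : ℝ} {F : Fin K → Model d → ℝ}
    (hF : ∀ k, SmoothWith L (F k)) : SmoothWith L (globalLoss F) := by
  refine ⟨?_, fun x y => ?_⟩
  · unfold _root_.globalLoss
    exact (Differentiable.fun_sum fun k _ => (hF k).1).const_mul _
  · rw [gradient_globalLoss fun k => (hF k).1, gradient_globalLoss fun k => (hF k).1,
      ← averageModel_sub, averageModel, norm_smul]
    have hK : (0 : ℝ) < K := Nat.cast_pos.2 (NeZero.pos K)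
    have h1 : ‖∑ k, (gradient (F k) x - gradient (F k) y)‖ ≤ ∑ _k : Fin K, L * ‖x - y‖ :=
      norm_sum_le_of_le _ fun k _ => (hF k).2 x y
    rw [Finset.sum_const, Finset.card_univ, Fintype.card_fin, nsmul_eq_mul] at h1
    rw [Real.norm_of_nonneg (by positivity), inv_mul_le_iff₀ hK]
    exact h1

theorem StronglyConvexWith.globalLoss [NeZero K] {L μ : ℝ} {F : Fin K → Model d → ℝ}
    (hF : ∀ k, SmoothWith L (F k)) (hc : ∀ k, StronglyConvexWith μ (F k)) :
    StronglyConvexWith μ (globalLoss F) := by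
  intro x y
  have hK : (0 : ℝ) < K := Nat.cast_pos.2 (NeZero.pos K)
  have h := Finset.sum_le_sum fun k (_ : k ∈ Finset.univ) => hc k x y
  have h' := mul_le_mul_of_nonneg_left h (inv_pos.2 hK).le
  rw [gradient_globalLoss fun k => (hF k).1]
  simp only [_root_.globalLoss, averageModel, inner_smul_left, sum_inner]
  simp only [Finset.sum_add_distrib, Finset.sum_const, Finset.card_univ, Fintype.card_fin,
    nsmul_eq_mul, mul_add, inv_mul_cancel_left₀ hK.ne'] at h'
  simpa using h'

end Average

/-! ### Centered gradient noise and independence. -/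

section Noise

variable {Ω H 𝒳 S : Type*} [MeasurableSpace Ω] {Pr : Measure Ω} [MeasurableSpace 𝒳]
  [MeasurableSpace S]

section Hilbert

variable [NormedAddCommGroup H] [InnerProductSpace ℝ H]

theorem integrable_inner_of_memLp_two {f h : Ω → H} (hf : MemLp f 2 Pr) (hh : MemLp h 2 Pr) :
    Integrable (fun ω => inner ℝ (f ω) (h ω)) Pr := by
  refine (hf.norm.integrable_mul hh.norm).mono (hf.1.inner hh.1) ?_
  filter_upwards with ω
  simpa using abs_real_inner_le_norm (f ω) (h ω)

variable [MeasurableSpace H]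

/-- The square-integrable random vector `Z` is orthogonal to the square-integrable functions of
the random variable `X`. -/
structure CenteredGiven (Pr : Measure Ω) (X : Ω → 𝒳) (Z : Ω → H) : Prop where
  memLp : MemLp Z 2 Pr
  integral_inner : ∀ φ : 𝒳 → H, Measurable φ → MemLp (fun ω => φ (X ω)) 2 Pr →
    ∫ ω, inner ℝ (φ (X ω)) (Z ω) ∂Pr = 0

namespace CenteredGiven

variable {X : Ω → 𝒳} {Z Z' : Ω → H}

theorem add (hZ : CenteredGiven Pr X Z) (hZ' : CenteredGiven Pr X Z') :
    CenteredGiven Pr X fun ω => Z ω + Z' ω where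
  memLp := hZ.memLp.add hZ'.memLp
  integral_inner φ hφ hφ2 := by
    simp_rw [inner_add_right]
    rw [integral_add (integrable_inner_of_memLp_two hφ2 hZ.memLp)
      (integrable_inner_of_memLp_two hφ2 hZ'.memLp), hZ.integral_inner φ hφ hφ2,
      hZ'.integral_inner φ hφ hφ2, add_zero]

theorem const_smul (hZ : CenteredGiven Pr X Z) (r : ℝ) :
    CenteredGiven Pr X fun ω => r • Z ω where
  memLp := hZ.memLp.const_smul r
  integral_inner φ hφ hφ2 := by
    simp_rw [inner_smul_right]
    rw [integral_const_mul, hZ.integral_inner φ hφ hφ2, mul_zero]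

theorem sub (hZ : CenteredGiven Pr X Z) (hZ' : CenteredGiven Pr X Z') :
    CenteredGiven Pr X fun ω => Z ω - Z' ω := by
  have := hZ.add (hZ'.const_smul (-1))
  simpa [sub_eq_add_neg] using this

theorem sum {ι : Type*} (s : Finset ι) {Z : ι → Ω → H} (hZ : ∀ i, CenteredGiven Pr X (Z i)) :
    CenteredGiven Pr X fun ω => ∑ i ∈ s, Z i ω where
  memLp := memLp_finsetSum s fun i _ => (hZ i).memLp
  integral_inner φ hφ hφ2 := by
    simp_rw [inner_sum]
    rw [integral_finsetSum _ fun i _ => integrable_inner_of_memLp_two hφ2 (hZ i).memLp]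
    exact Finset.sum_eq_zero fun i _ => (hZ i).integral_inner φ hφ hφ2

/-- Pythagoras: orthogonality kills the cross term. This separates every stochastic step into its
deterministic part and a variance. -/
theorem integral_norm_sub_smul_sq (hZ : CenteredGiven Pr X Z) {φ : 𝒳 → H} (hφ : Measurable φ)
    (hφ2 : MemLp (fun ω => φ (X ω)) 2 Pr) (ε : ℝ) :
    ∫ ω, ‖φ (X ω) - ε • Z ω‖ ^ 2 ∂Pr
      = ∫ ω, ‖φ (X ω)‖ ^ 2 ∂Pr + ε ^ 2 * ∫ ω, ‖Z ω‖ ^ 2 ∂Pr := by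
  have h1 := (memLp_two_iff_integrable_sq_norm hφ2.1).1 hφ2
  have h2 := (memLp_two_iff_integrable_sq_norm hZ.memLp.1).1 hZ.memLp
  have h3 := integrable_inner_of_memLp_two hφ2 hZ.memLp
  have h4 : ∀ ω, ‖φ (X ω) - ε • Z ω‖ ^ 2
      = ‖φ (X ω)‖ ^ 2 - 2 * ε * inner ℝ (φ (X ω)) (Z ω) + ε ^ 2 * ‖Z ω‖ ^ 2 := by
    intro ω
    rw [norm_sub_sq_real, inner_smul_right, norm_smul, mul_pow, Real.norm_eq_abs, sq_abs]
    ring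
  simp_rw [h4]
  have h5 : Integrable (fun ω => ‖φ (X ω)‖ ^ 2 - 2 * ε * inner ℝ (φ (X ω)) (Z ω)) Pr :=
    h1.sub (h3.const_mul _)
  rw [integral_add h5 (h2.const_mul _), integral_sub h1 (h3.const_mul _),
    integral_const_mul, integral_const_mul, hZ.integral_inner φ hφ hφ2]
  ring

end CenteredGiven

end Hilbert

variable {d : ℕ} {F : Model d → ℝ} {L ϱ : ℝ}

theorem SmoothWith.memLp_gradient [IsFiniteMeasure Pr] (hF : SmoothWith L F) {Y : Ω → Model d}
    (hY : MemLp Y 2 Pr) : MemLp (fun ω => gradient F (Y ω)) 2 Pr := by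
  have h0 : MemLp (fun ω => gradient F (Y ω) - gradient F 0) 2 Pr := by
    refine hY.of_le_mul (c := L) ?_ ?_
    · exact (hF.continuous_gradient.comp_aestronglyMeasurable hY.1).sub
        aestronglyMeasurable_const
    · filter_upwards with ω
      simpa using hF.2 (Y ω) 0
  refine (h0.add (memLp_const (gradient F 0))).congr_norm ?_ (.of_forall fun ω => by simp)
  exact hF.continuous_gradient.comp_aestronglyMeasurable hY.1

/-- Independence makes the joint law of state and mini-batch a product. Fubini then freezes the
state, and the pointwise unbiasedness and variance bound apply to the inner integral. -/
theorem BoundedVarianceGradient.centeredGiven [IsProbabilityMeasure Pr] {P : Measure S}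
    [IsProbabilityMeasure P] {g : Model d → S → Model d} (hg : BoundedVarianceGradient P ϱ F g)
    (hF : SmoothWith L F) {X : Ω → 𝒳} {ξ : Ω → S} (hX : Measurable X) (hξ : Measurable ξ)
    (hmap : Measure.map ξ Pr = P) (hind : IndepFun X ξ Pr) {x : 𝒳 → Model d}
    (hx : Measurable x) :
    CenteredGiven Pr X (fun ω => g (x (X ω)) (ξ ω) - gradient F (x (X ω))) ∧
      ∫ ω, ‖g (x (X ω)) (ξ ω) - gradient F (x (X ω))‖ ^ 2 ∂Pr ≤ ϱ ^ 2 := by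
  let N : 𝒳 × S → Model d := fun p => g (x p.1) p.2 - gradient F (x p.1)
  have hN : Measurable N := by
    refine Measurable.sub ?_ ?_
    · exact hg.measurable.comp ((hx.comp measurable_fst).prodMk measurable_snd)
    · exact hF.continuous_gradient.measurable.comp (hx.comp measurable_fst)
  have hprod : Measure.map (fun ω => (X ω, ξ ω)) Pr = (Measure.map X Pr).prod P := by
    rw [← hmap]
    exact (indepFun_iff_map_prod_eq_prod_map_map hX.aemeasurable hξ.aemeasurable).1 hind
  have hprob : IsProbabilityMeasure (Measure.map X Pr) :=
    Measure.isProbabilityMeasure_map hX.aemeasurable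
  have hpair : Measurable fun ω => (X ω, ξ ω) := hX.prodMk hξ
  have hsq : Integrable (fun p => ‖N p‖ ^ 2) ((Measure.map X Pr).prod P) := by
    have hm : AEStronglyMeasurable (fun p => ‖N p‖ ^ 2) ((Measure.map X Pr).prod P) :=
      (hN.norm.pow_const 2).aestronglyMeasurable
    -- The slice integrals are at most `ϱ ^ 2` uniformly in the state, which suffices under a
    -- probability measure.
    rw [integrable_prod_iff hm]
    refine ⟨.of_forall fun y => hg.integrable_sq (x y), ?_⟩
    refine Integrable.of_bound hm.norm.integral_prod_right' (ϱ ^ 2) (.of_forall fun y => ?_)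
    have := hg.variance_le (x y)
    rw [Real.norm_of_nonneg (integral_nonneg fun s => norm_nonneg _)]
    simpa [N] using this
  have hsqΩ : Integrable (fun ω => ‖N (X ω, ξ ω)‖ ^ 2) Pr := by
    rw [← hprod] at hsq
    exact (integrable_map_measure (hN.norm.pow_const 2).aestronglyMeasurable
      hpair.aemeasurable).1 hsq
  have hmem : MemLp (fun ω => N (X ω, ξ ω)) 2 Pr :=
    (memLp_two_iff_integrable_sq_norm (hN.comp hpair).aestronglyMeasurable).2 hsqΩ
  refine ⟨⟨hmem, fun φ hφ hφ2 => ?_⟩, ?_⟩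
  · have hm : Measurable fun p : 𝒳 × S => inner ℝ (φ p.1) (N p) :=
      (hφ.comp measurable_fst).inner hN
    have h1 := integrable_inner_of_memLp_two hφ2 hmem
    have h2 : Integrable (fun p : 𝒳 × S => inner ℝ (φ p.1) (N p)) ((Measure.map X Pr).prod P) := by
      rw [← hprod]
      exact (integrable_map_measure hm.aestronglyMeasurable hpair.aemeasurable).2 h1
    have h3 := integral_map (μ := Pr) hpair.aemeasurable
      (hm.aestronglyMeasurable (μ := Measure.map (fun ω => (X ω, ξ ω)) Pr))
    refine h3.symm.trans ?_
    rw [hprod, integral_prod _ h2]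
    refine integral_eq_zero_of_ae (.of_forall fun y => ?_)
    simp only [N, Pi.zero_apply]
    have h4 : Integrable (fun s => g (x y) s - gradient F (x y)) P :=
      (hg.integrable _).sub (integrable_const _)
    rw [integral_inner h4,
      integral_sub (hg.integrable _) (integrable_const _), hg.unbiased]
    simp
  · have h3 := integral_map (μ := Pr) hpair.aemeasurable
      ((hN.norm.pow_const 2).aestronglyMeasurable (μ := Measure.map (fun ω => (X ω, ξ ω)) Pr))
    refine h3.symm.trans_le ?_
    rw [hprod, integral_prod _ hsq]
    calc _ ≤ ∫ _y, ϱ ^ 2 ∂(Measure.map X Pr) :=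
          integral_mono hsq.integral_prod_left (integrable_const _) fun y => hg.variance_le (x y)
      _ = ϱ ^ 2 := by simp

/-- The hypotheses factor the law of the triple into three marginals; reassociating the product
regroups them. -/
theorem IndepFun.prodMk_left_of_prodMk_right {A B C : Type*} [MeasurableSpace A]
    [MeasurableSpace B] [MeasurableSpace C] [IsProbabilityMeasure Pr] {X : Ω → A} {Y : Ω → B}
    {Z : Ω → C} (hX : Measurable X) (hY : Measurable Y) (hZ : Measurable Z)
    (h : IndepFun X (fun ω => (Y ω, Z ω)) Pr) (h' : IndepFun Y Z Pr) :
    IndepFun (fun ω => (X ω, Y ω)) Z Pr := by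
  have h1 := (indepFun_iff_map_prod_eq_prod_map_map hX.aemeasurable
    (hY.prodMk hZ).aemeasurable).1 h
  have h2 := (indepFun_iff_map_prod_eq_prod_map_map hY.aemeasurable hZ.aemeasurable).1 h'
  have h3 : IndepFun X Y Pr := h.comp measurable_id measurable_fst
  have h4 := (indepFun_iff_map_prod_eq_prod_map_map hX.aemeasurable hY.aemeasurable).1 h3
  rw [indepFun_iff_map_prod_eq_prod_map_map (hX.prodMk hY).aemeasurable hZ.aemeasurable, h4]
  have := Measure.isProbabilityMeasure_map (μ := Pr) hX.aemeasurable
  have := Measure.isProbabilityMeasure_map (μ := Pr) hY.aemeasurable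
  have := Measure.isProbabilityMeasure_map (μ := Pr) hZ.aemeasurable
  have h5 : (fun ω => ((X ω, Y ω), Z ω))
      = MeasurableEquiv.prodAssoc.symm ∘ fun ω => (X ω, (Y ω, Z ω)) := rfl
  rw [h5, ← Measure.map_map (MeasurableEquiv.measurable _) (hX.prodMk (hY.prodMk hZ)), h1, h2]
  exact ((measurePreserving_prodAssoc _ _ _).symm _).map_eq

end Noise

/-! ### Deterministic one-step inequalities. -/

section OneStep

variable {d K : ℕ} {L μ ε : ℝ}

/-- The weight is kept free: the drift estimates take `r = G`, so that the factor `1 + 1 / G` stays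
bounded over a block of `G` steps. -/
theorem norm_add_sq_le_young {H : Type*} [NormedAddCommGroup H] [InnerProductSpace ℝ H] {r : ℝ}
    (hr : 0 < r) (x y : H) : ‖x + y‖ ^ 2 ≤ (1 + 1 / r) * ‖x‖ ^ 2 + (1 + r) * ‖y‖ ^ 2 := by
  have h1 : ‖x + y‖ ^ 2 ≤ (‖x‖ + ‖y‖) ^ 2 := by gcongr; exact norm_add_le x y
  have h2 : 0 ≤ (‖x‖ - r * ‖y‖) ^ 2 / r := by positivity
  have h3 : (‖x‖ - r * ‖y‖) ^ 2 / r = 1 / r * ‖x‖ ^ 2 - 2 * ‖x‖ * ‖y‖ + r * ‖y‖ ^ 2 := by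
    field_simp
    ring
  nlinarith

theorem norm_add_sq_le_two_mul {H : Type*} [NormedAddCommGroup H] [InnerProductSpace ℝ H]
    (x y : H) : ‖x + y‖ ^ 2 ≤ 2 * ‖x‖ ^ 2 + 2 * ‖y‖ ^ 2 := by
  have := norm_add_sq_le_young one_pos x y
  norm_num at this
  exact this

theorem norm_sub_sq_le_two_mul {H : Type*} [NormedAddCommGroup H] [InnerProductSpace ℝ H]
    (x y : H) : ‖x - y‖ ^ 2 ≤ 2 * ‖x‖ ^ 2 + 2 * ‖y‖ ^ 2 := by
  simpa [sub_eq_add_neg] using norm_add_sq_le_two_mul x (-y)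

/-- The average of the local gradients at the copies, compared with the global gradient at the
average of the copies. -/
theorem norm_averageModel_gradient_sub_sq_le [NeZero K] {F : Fin K → Model d → ℝ}
    (hF : ∀ k, SmoothWith L (F k)) (u : Fin K → Model d) :
    ‖averageModel (fun j => gradient (F j) (u j))
        - gradient (globalLoss F) (averageModel u)‖ ^ 2
      ≤ L ^ 2 * ((K : ℝ)⁻¹ * ∑ j, ‖u j - averageModel u‖ ^ 2) := by
  rw [gradient_globalLoss fun k => (hF k).1, ← averageModel_sub]
  refine (norm_averageModel_sq_le _).trans ?_
  have h : ∑ j, ‖gradient (F j) (u j) - gradient (F j) (averageModel u)‖ ^ 2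
      ≤ ∑ j, L ^ 2 * ‖u j - averageModel u‖ ^ 2 := by
    refine Finset.sum_le_sum fun j _ => ?_
    rw [← mul_pow]
    exact pow_le_pow_left₀ (norm_nonneg _) ((hF j).2 _ _) 2
  rw [← Finset.mul_sum] at h
  rw [mul_left_comm]
  gcongr

/-- The difference is that of two exact gradient steps, which is nonexpansive, plus `ε • (b -
gradient f y)`. Only the gradient mismatch at the common point `y` is paid for. -/
theorem norm_gradient_step_sub_sq_le {f : Model d → ℝ} (hL : 0 < L) (hf : SmoothWith L f)
    (hconv : ∀ x y : Model d, f y + inner ℝ (gradient f y) (x - y) ≤ f x)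
    (hε : 0 ≤ ε) (hεL : ε * L ≤ 2) {r : ℝ} (hr : 0 < r) (x y b : Model d) :
    ‖x - ε • gradient f x - (y - ε • b)‖ ^ 2
      ≤ (1 + 1 / r) * ‖x - y‖ ^ 2 + (1 + r) * (ε ^ 2 * ‖b - gradient f y‖ ^ 2) := by
  have h1 : x - ε • gradient f x - (y - ε • b)
      = (x - y - ε • (gradient f x - gradient f y)) + ε • (b - gradient f y) := by
    module
  rw [h1]
  refine (norm_add_sq_le_young hr _ _).trans ?_
  rw [norm_smul, mul_pow, Real.norm_of_nonneg hε]
  gcongr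
  exact hf.norm_gradient_step_sub_le hL hconv hε hεL x y

/-- A step along a perturbed gradient evaluated at a perturbed point. -/
theorem norm_perturbed_step_sub_sq_le {f : Model d → ℝ} (hL : 0 < L) (hμ : 0 < μ) (hμL : μ ≤ L)
    (hf : SmoothWith L f) (hc : StronglyConvexWith μ f) {x₀ : Model d}
    (h₀ : gradient f x₀ = 0) (hε : 0 ≤ ε) (hεL : ε * L ≤ 1 / 8) {ρ θ : ℝ} (hρ : 3 / 4 ≤ ρ)
    (hρ1 : ρ ≤ 1) (hθ : 0 ≤ θ) (v x b : Model d) :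
    ‖v - ε • (ρ • gradient f x + θ • b) - x₀‖ ^ 2
      ≤ (1 - 5 / 16 * (μ * ε)) * ‖v - x₀‖ ^ 2 + 3 * ε * L * ‖v - x‖ ^ 2
        + 17 * (ε / μ) * (θ ^ 2 * ‖b‖ ^ 2) := by
  set A := gradient f x with hA
  have hAsq : ‖A‖ ^ 2 ≤ 2 * L * (f x - f x₀) := hf.sq_norm_gradient_le hL (hc.le hμ.le) h₀ x
  -- Splitting `v - x₀` at `x`, strong convexity handles `x - x₀`; Young and `hAsq` handle `v - x`
  -- at the price of half the gap.
  have hinner : (f x - f x₀) / 2 + μ / 2 * ‖x - x₀‖ ^ 2 - L * ‖v - x‖ ^ 2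
      ≤ inner ℝ (v - x₀) A := by
    have h1 := hc x₀ x
    have h2 : inner ℝ (v - x₀) A = inner ℝ (v - x) A - inner ℝ A (x₀ - x) := by
      rw [real_inner_comm (x₀ - x) A, ← inner_sub_left]
      congr 1
      abel
    have h3 := abs_real_inner_le_norm (v - x) A
    have h4 := neg_abs_le (inner ℝ (v - x) A)
    have h5 : 0 ≤ (2 * L * ‖v - x‖ - ‖A‖) ^ 2 := sq_nonneg _
    have h6 : ‖v - x‖ * ‖A‖ ≤ L * ‖v - x‖ ^ 2 + (f x - f x₀) / 2 := by
      have : 4 * L * (‖v - x‖ * ‖A‖) ≤ 4 * L * (L * ‖v - x‖ ^ 2 + (f x - f x₀) / 2) := by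
        nlinarith
      exact le_of_mul_le_mul_left this (by positivity)
    rw [norm_sub_rev x₀ x] at h1
    rw [h2]
    linarith
  have hdist : ‖v - x₀‖ ^ 2 ≤ 2 * ‖v - x‖ ^ 2 + 2 * ‖x - x₀‖ ^ 2 := by
    simpa using norm_add_sq_le_two_mul (v - x) (x - x₀)
  -- The weight `μ / 16` is what reduces the contraction `3 / 8` of `e5` to `5 / 16`.
  have hcross : -(2 * ε * θ * inner ℝ (v - x₀) b)
      ≤ ε * (μ / 16 * ‖v - x₀‖ ^ 2 + 16 / μ * (θ ^ 2 * ‖b‖ ^ 2)) := by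
    have h1 := abs_real_inner_le_norm (v - x₀) b
    have h2 := neg_abs_le (inner ℝ (v - x₀) b)
    have h3 : 0 ≤ (μ * ‖v - x₀‖ - 16 * (θ * ‖b‖)) ^ 2 / (16 * μ) := by positivity
    have h4 : (μ * ‖v - x₀‖ - 16 * (θ * ‖b‖)) ^ 2 / (16 * μ)
        = μ / 16 * ‖v - x₀‖ ^ 2 + 16 / μ * (θ ^ 2 * ‖b‖ ^ 2)
          - 2 * θ * (‖v - x₀‖ * ‖b‖) := by
      field_simp
      ring
    have h5 : -(2 * θ * inner ℝ (v - x₀) b) ≤ 2 * θ * (‖v - x₀‖ * ‖b‖) := by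
      nlinarith
    calc _ = ε * -(2 * θ * inner ℝ (v - x₀) b) := by ring
      _ ≤ _ := by gcongr; linarith
  have hexp : ‖v - ε • (ρ • A + θ • b) - x₀‖ ^ 2 = ‖v - x₀‖ ^ 2
      - 2 * ε * ρ * inner ℝ (v - x₀) A - 2 * ε * θ * inner ℝ (v - x₀) b
      + ε ^ 2 * ‖ρ • A + θ • b‖ ^ 2 := by
    rw [show v - ε • (ρ • A + θ • b) - x₀ = (v - x₀) - ε • (ρ • A + θ • b) by abel,
      norm_sub_sq_real, inner_smul_right, inner_add_right, inner_smul_right, inner_smul_right,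
      norm_smul, mul_pow, Real.norm_of_nonneg hε]
    ring
  have hsq : ‖ρ • A + θ • b‖ ^ 2 ≤ 2 * ρ * ‖A‖ ^ 2 + 2 * (θ ^ 2 * ‖b‖ ^ 2) := by
    refine (norm_add_sq_le_two_mul _ _).trans ?_
    rw [norm_smul, norm_smul, mul_pow, mul_pow, Real.norm_of_nonneg hθ,
      Real.norm_of_nonneg (by linarith)]
    have : ρ ^ 2 ≤ ρ := by nlinarith
    nlinarith [mul_le_mul_of_nonneg_right this (sq_nonneg ‖A‖)]
  have hgap : 0 ≤ f x - f x₀ := by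
    by_contra! h
    nlinarith [sq_nonneg ‖A‖]
  have hρ0 : 0 ≤ ρ := by linarith
  -- The small step size lets the gap left in `hinner` absorb the second-order gradient term.
  have e1 : ε ^ 2 * (2 * ρ * ‖A‖ ^ 2) ≤ ε * ρ * ((f x - f x₀) / 2) := by
    have : ε * ‖A‖ ^ 2 ≤ (f x - f x₀) / 4 := by
      calc ε * ‖A‖ ^ 2 ≤ ε * (2 * L * (f x - f x₀)) := by gcongr
        _ = ε * L * (2 * (f x - f x₀)) := by ring
        _ ≤ 1 / 8 * (2 * (f x - f x₀)) := by gcongr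
        _ = _ := by ring
    calc _ = 2 * (ε * ρ) * (ε * ‖A‖ ^ 2) := by ring
      _ ≤ 2 * (ε * ρ) * ((f x - f x₀) / 4) := by gcongr
      _ = _ := by ring
  have e2 : ε ^ 2 * (2 * (θ ^ 2 * ‖b‖ ^ 2)) ≤ ε / μ * (θ ^ 2 * ‖b‖ ^ 2) := by
    have h1 : ε * μ ≤ 1 / 8 := (mul_le_mul_of_nonneg_left hμL hε).trans hεL
    have h2 : ε ^ 2 * 2 ≤ ε / μ := by
      rw [le_div_iff₀ hμ]
      nlinarith
    calc _ = ε ^ 2 * 2 * (θ ^ 2 * ‖b‖ ^ 2) := by ring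
      _ ≤ _ := by gcongr
  have e3 := mul_le_mul_of_nonneg_left hinner (mul_nonneg hε hρ0)
  have e4 := mul_le_mul_of_nonneg_left hsq (sq_nonneg ε)
  have e5 : 2 * (ε * ρ) * (μ / 2 * ‖x - x₀‖ ^ 2)
      ≥ 3 / 8 * (μ * ε) * ‖v - x₀‖ ^ 2 - ε * L * ‖v - x‖ ^ 2 := by
    have h1 : ε * ρ * μ * (‖v - x₀‖ ^ 2 / 2 - ‖v - x‖ ^ 2) ≤ ε * ρ * μ * ‖x - x₀‖ ^ 2 := by
      gcongr
      linarith
    have h2 : 3 / 4 * (ε * μ * (‖v - x₀‖ ^ 2 / 2)) ≤ ρ * (ε * μ * (‖v - x₀‖ ^ 2 / 2)) := by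
      gcongr
    have h3 : ρ * (ε * μ * ‖v - x‖ ^ 2) ≤ 1 * (ε * L * ‖v - x‖ ^ 2) := by gcongr
    linarith
  have e6 : ρ * (ε * L * ‖v - x‖ ^ 2) ≤ 1 * (ε * L * ‖v - x‖ ^ 2) := by gcongr
  have e7 : 0 ≤ ε * ρ * ((f x - f x₀) / 2) := by positivity
  have e8 : ε * (μ / 16 * ‖v - x₀‖ ^ 2 + 16 / μ * (θ ^ 2 * ‖b‖ ^ 2))
      = μ * ε * ‖v - x₀‖ ^ 2 / 16 + 16 * (ε / μ) * (θ ^ 2 * ‖b‖ ^ 2) := by ring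
  rw [hexp]
  linarith

/-- A step along an inexact gradient. -/
theorem norm_inexact_step_sub_sq_le {f : Model d → ℝ} (hL : 0 < L) (hμ : 0 < μ) (hμL : μ ≤ L)
    (hf : SmoothWith L f) (hc : StronglyConvexWith μ f) {x₀ : Model d}
    (h₀ : gradient f x₀ = 0) (hε : 0 ≤ ε) (hεL : ε * L ≤ 1 / 8) {x b : Model d} {B : ℝ}
    (hb : ‖b - gradient f x‖ ^ 2 ≤ B) :
    ‖b‖ ^ 2 ≤ 2 * B + 4 * L * (f x - f x₀) ∧
    ‖x - ε • b - x₀‖ ^ 2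
      ≤ (1 - μ * ε / 2) * ‖x - x₀‖ ^ 2 - 3 / 2 * ε * (f x - f x₀) + 3 * (ε / μ) * B := by
  have hAsq := hf.sq_norm_gradient_le hL (hc.le hμ.le) h₀ x
  have hb2 : ‖b‖ ^ 2 ≤ 2 * B + 4 * L * (f x - f x₀) := by
    have := norm_add_sq_le_two_mul (b - gradient f x) (gradient f x)
    rw [sub_add_cancel] at this
    linarith
  have hB : 0 ≤ B := (sq_nonneg _).trans hb
  have hgap : 0 ≤ f x - f x₀ := by
    by_contra! h
    nlinarith [sq_nonneg ‖gradient f x‖]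
  refine ⟨hb2, ?_⟩
  have hinner : f x - f x₀ + μ / 2 * ‖x - x₀‖ ^ 2 - (μ / 4 * ‖x - x₀‖ ^ 2 + B / μ)
      ≤ inner ℝ (x - x₀) b := by
    have h1 := hc x₀ x
    have h2 : inner ℝ (x - x₀) b
        = inner ℝ (x - x₀) (b - gradient f x) - inner ℝ (gradient f x) (x₀ - x) := by
      rw [inner_sub_right, real_inner_comm (x₀ - x), ← neg_sub x x₀, inner_neg_left]
      ring
    have h3 := abs_real_inner_le_norm (x - x₀) (b - gradient f x)
    have h4 := neg_abs_le (inner ℝ (x - x₀) (b - gradient f x))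
    have h5 : 0 ≤ (μ * ‖x - x₀‖ - 2 * ‖b - gradient f x‖) ^ 2 / (4 * μ) := by positivity
    have h6 : (μ * ‖x - x₀‖ - 2 * ‖b - gradient f x‖) ^ 2 / (4 * μ)
        = μ / 4 * ‖x - x₀‖ ^ 2 + ‖b - gradient f x‖ ^ 2 / μ
          - ‖x - x₀‖ * ‖b - gradient f x‖ := by
      field_simp
      ring
    have h7 : ‖b - gradient f x‖ ^ 2 / μ ≤ B / μ := by gcongr
    rw [norm_sub_rev x₀ x] at h1
    rw [h2]
    linarith
  have hexp : ‖x - ε • b - x₀‖ ^ 2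
      = ‖x - x₀‖ ^ 2 - 2 * ε * inner ℝ (x - x₀) b + ε ^ 2 * ‖b‖ ^ 2 := by
    rw [show x - ε • b - x₀ = (x - x₀) - ε • b by abel, norm_sub_sq_real, inner_smul_right,
      norm_smul, mul_pow, Real.norm_of_nonneg hε]
    ring
  -- Of the `2 * ε` times the gap supplied by `hinner`, only a quarter is spent here; the remaining
  -- `3 / 2` pays for the personalized model in the coupled step.
  have e1 : ε ^ 2 * ‖b‖ ^ 2 ≤ ε * (f x - f x₀) / 2 + ε / μ * B := by
    have h1 : ε * μ ≤ 1 / 8 := (mul_le_mul_of_nonneg_left hμL hε).trans hεL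
    have h2 : ε ^ 2 * 2 ≤ ε / μ := by
      rw [le_div_iff₀ hμ]
      nlinarith
    calc ε ^ 2 * ‖b‖ ^ 2 ≤ ε ^ 2 * (2 * B + 4 * L * (f x - f x₀)) := by gcongr
      _ = ε ^ 2 * 2 * B + ε * L * (4 * ε * (f x - f x₀)) := by ring
      _ ≤ ε / μ * B + 1 / 8 * (4 * ε * (f x - f x₀)) := by gcongr
      _ = _ := by ring
  have e2 := mul_le_mul_of_nonneg_left hinner hε
  have e3 : ε * (B / μ) = ε / μ * B := by ring
  rw [hexp]
  linarith

/-- One step of the coupled iteration of the personalized model `v` and of the global model. -/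
theorem coupled_step_le [NeZero K] {F : Fin K → Model d → ℝ} (hL : 0 < L) (hμ : 0 < μ)
    (hμL : μ ≤ L) (hF : ∀ k, SmoothWith L (F k)) (hc : ∀ k, StronglyConvexWith μ (F k))
    {κ : ℝ} (hκ : κ = L / μ) {k : Fin K} {x₀ y₀ : Model d} (hx₀ : gradient (F k) x₀ = 0)
    (hy₀ : gradient (globalLoss F) y₀ = 0) (hε : 0 ≤ ε) (hεL : ε * L ≤ 1 / 8) {ρ θ : ℝ}
    (hρ : 3 / 4 ≤ ρ) (hρ1 : ρ ≤ 1) (hθ : 0 ≤ θ) (v x : Model d) (u : Fin K → Model d)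
    (hvx : v - x = -(θ • (u k - averageModel u))) :
    ‖v - ε • (ρ • gradient (F k) x + θ • averageModel fun j => gradient (F j) (u j)) - x₀‖ ^ 2
      + 46 * κ * θ ^ 2 *
        ‖averageModel u - ε • (averageModel fun j => gradient (F j) (u j)) - y₀‖ ^ 2
      ≤ (1 - 5 / 16 * (μ * ε)) * (‖v - x₀‖ ^ 2 + 46 * κ * θ ^ 2 * ‖averageModel u - y₀‖ ^ 2)
        + ε * L * θ ^ 2 * (3 * ‖u k - averageModel u‖ ^ 2
          + 172 * κ ^ 2 * ((K : ℝ)⁻¹ * ∑ j, ‖u j - averageModel u‖ ^ 2)) := by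
  set b := averageModel fun j => gradient (F j) (u j) with hb
  set D := (K : ℝ)⁻¹ * ∑ j, ‖u j - averageModel u‖ ^ 2 with hD
  have hD0 : 0 ≤ D := by positivity
  have hκ1 : 1 ≤ κ := by rw [hκ, one_le_div hμ]; exact hμL
  have h1 := norm_perturbed_step_sub_sq_le hL hμ hμL (hF k) (hc k) hx₀ hε hεL hρ hρ1 hθ v x b
  obtain ⟨h2, h3⟩ := norm_inexact_step_sub_sq_le hL hμ hμL (SmoothWith.globalLoss hF)
    (StronglyConvexWith.globalLoss hF hc) hy₀ hε hεL (norm_averageModel_gradient_sub_sq_le hF u)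
  rw [← hb, ← hD] at h2 h3
  rw [hvx, norm_neg, norm_smul, mul_pow, Real.norm_of_nonneg hθ] at h1
  set γ := globalLoss F (averageModel u) - globalLoss F y₀
  have hγ : 0 ≤ γ := by
    have := (SmoothWith.globalLoss hF).sq_norm_gradient_le hL
      ((StronglyConvexWith.globalLoss hF hc).le hμ.le) hy₀ (averageModel u)
    by_contra! h
    nlinarith [sq_nonneg ‖gradient (globalLoss F) (averageModel u)‖]
  -- This fixes the weight 46: the cost `68 * κ` of the gap is covered by `46 * 3 / 2 = 69`. The
  -- drift coefficient becomes `34 + 46 * 3 = 172`.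
  have h4 : 17 * (ε / μ) * (θ ^ 2 * ‖b‖ ^ 2)
      ≤ ε * L * θ ^ 2 * (34 * κ ^ 2 * D) + 68 * κ * θ ^ 2 * ε * γ := by
    calc 17 * (ε / μ) * (θ ^ 2 * ‖b‖ ^ 2)
        ≤ 17 * (ε / μ) * (θ ^ 2 * (2 * (L ^ 2 * D) + 4 * L * γ)) := by gcongr
      _ = ε * L * θ ^ 2 * (34 * (κ * 1) * D) + 68 * κ * θ ^ 2 * ε * γ := by
        rw [hκ]; field_simp; ring
      _ ≤ ε * L * θ ^ 2 * (34 * (κ * κ) * D) + 68 * κ * θ ^ 2 * ε * γ := by gcongr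
      _ = _ := by ring
  have h5 : 46 * κ * θ ^ 2 * (3 * (ε / μ) * (L ^ 2 * D))
      = ε * L * θ ^ 2 * (138 * κ ^ 2 * D) := by
    rw [hκ]; field_simp; ring
  have h6 := mul_le_mul_of_nonneg_left h3 (by positivity : 0 ≤ 46 * κ * θ ^ 2)
  have h7 : 0 ≤ κ * θ ^ 2 * ε * γ := by positivity
  have h8 : 0 ≤ 46 * κ * θ ^ 2 * (μ * ε * ‖averageModel u - y₀‖ ^ 2) := by positivity
  linarith

end OneStep

/-! ### Drift and coupled error of a run with additive noise. -/

section Run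

variable {d K : ℕ} {Ω : Type*} [MeasurableSpace Ω]

theorem integrable_norm_sq_of_memLp_two {H : Type*} [NormedAddCommGroup H] {Pr : Measure Ω}
    {f : Ω → H} (hf : MemLp f 2 Pr) : Integrable (fun ω => ‖f ω‖ ^ 2) Pr :=
  (memLp_two_iff_integrable_sq_norm hf.1).1 hf

theorem MemLp.fun_add {H : Type*} [NormedAddCommGroup H] {Pr : Measure Ω} {f g : Ω → H}
    (hf : MemLp f 2 Pr) (hg : MemLp g 2 Pr) : MemLp (fun ω => f ω + g ω) 2 Pr :=
  MemLp.add hf hg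

theorem MemLp.fun_sub {H : Type*} [NormedAddCommGroup H] {Pr : Measure Ω} {f g : Ω → H}
    (hf : MemLp f 2 Pr) (hg : MemLp g 2 Pr) : MemLp (fun ω => f ω - g ω) 2 Pr :=
  MemLp.sub hf hg

theorem MemLp.fun_const_smul {H : Type*} [NormedAddCommGroup H] [NormedSpace ℝ H]
    {Pr : Measure Ω} {f : Ω → H} (hf : MemLp f 2 Pr) (r : ℝ) : MemLp (fun ω => r • f ω) 2 Pr :=
  MemLp.const_smul hf r

theorem memLp_averageModel {Pr : Measure Ω} {z : Ω → Fin K → Model d}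
    (hz : ∀ j, MemLp (fun ω => z ω j) 2 Pr) : MemLp (fun ω => averageModel (z ω)) 2 Pr := by
  have h : MemLp (fun ω => ∑ j, z ω j) 2 Pr := memLp_finsetSum _ fun j _ => hz j
  exact MemLp.fun_const_smul h (K : ℝ)⁻¹

theorem CenteredGiven.averageModel {𝒳 : Type*} [MeasurableSpace 𝒳] {Pr : Measure Ω} {X : Ω → 𝒳}
    {Z : Fin K → Ω → Model d} (hZ : ∀ j, CenteredGiven Pr X (Z j)) :
    CenteredGiven Pr X fun ω => averageModel fun j => Z j ω :=
  (CenteredGiven.sum _ hZ).const_smul _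

theorem integral_norm_averageModel_sq_le [NeZero K] {Pr : Measure Ω} {Z : Fin K → Ω → Model d}
    {b : ℝ} (hZ : ∀ j, MemLp (Z j) 2 Pr) (hb : ∀ j, ∫ ω, ‖Z j ω‖ ^ 2 ∂Pr ≤ b) :
    ∫ ω, ‖averageModel fun j => Z j ω‖ ^ 2 ∂Pr ≤ b := by
  have hK : (0 : ℝ) < K := Nat.cast_pos.2 (NeZero.pos K)
  have hi : ∀ j ∈ Finset.univ, Integrable (fun ω => ‖Z j ω‖ ^ 2) Pr :=
    fun j _ => integrable_norm_sq_of_memLp_two (hZ j)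
  calc _ ≤ ∫ ω, (K : ℝ)⁻¹ * ∑ j, ‖Z j ω‖ ^ 2 ∂Pr :=
        integral_mono (integrable_norm_sq_of_memLp_two (memLp_averageModel hZ))
          ((integrable_finsetSum _ hi).const_mul _) fun ω => norm_averageModel_sq_le _
    _ = (K : ℝ)⁻¹ * ∑ j, ∫ ω, ‖Z j ω‖ ^ 2 ∂Pr := by
        rw [integral_const_mul, integral_finsetSum _ hi]
    _ ≤ (K : ℝ)⁻¹ * ∑ _j : Fin K, b := by gcongr with j _; exact hb j
    _ = b := by simp [hK.ne']

/-- A run of personalized federated learning with additive gradient noise: `n` perturbs the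
gradients in the updates of the copies `U` of the global model and `m` those in the updates of the
local models `W`. -/
structure NoisyRun (Pr : Measure Ω) (F : Fin K → Model d → ℝ) (ε : ℕ → ℝ) (G : ℕ)
    (ψ : Fin K → ℝ) (ϱ : ℝ) (U W : ℕ → Ω → Fin K → Model d) (n m : ℕ → Fin K → Ω → Model d) :
    Prop where
  memLp_copies_zero : ∀ j, MemLp (fun ω => U 0 ω j) 2 Pr
  memLp_local_zero : ∀ j, MemLp (fun ω => W 0 ω j) 2 Pr
  copies_zero : ∀ ω j, U 0 ω j = averageModel (U 0 ω)
  copies_succ : ∀ t ω, U (t + 1) ω = if G ∣ t + 1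
    then fun _ => averageModel fun j => U t ω j - ε t • (gradient (F j) (U t ω j) + n t j ω)
    else fun j => U t ω j - ε t • (gradient (F j) (U t ω j) + n t j ω)
  local_succ : ∀ t ω j, W (t + 1) ω j = W t ω j - ε t • ψ j •
    (gradient (F j) (ψ j • W t ω j + (1 - ψ j) • U t ω j) + m t j ω)
  centered_copies : ∀ t j, CenteredGiven Pr (fun ω => (U t ω, W t ω)) (n t j)
  centered_local : ∀ t j, CenteredGiven Pr (fun ω => (U t ω, W t ω)) (m t j)
  variance_copies_le : ∀ t j, ∫ ω, ‖n t j ω‖ ^ 2 ∂Pr ≤ ϱ ^ 2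
  variance_local_le : ∀ t j, ∫ ω, ‖m t j ω‖ ^ 2 ∂Pr ≤ ϱ ^ 2

/-- The mean squared distance of the copy of device `j` and the average of the copies. -/
noncomputable def copyDrift (Pr : Measure Ω) (U : ℕ → Ω → Fin K → Model d) (t : ℕ) (j : Fin K) :
    ℝ :=
  ∫ ω, ‖U t ω j - averageModel (U t ω)‖ ^ 2 ∂Pr

theorem copyDrift_nonneg (Pr : Measure Ω) (U : ℕ → Ω → Fin K → Model d) (t : ℕ) (j : Fin K) :
    0 ≤ copyDrift Pr U t j :=
  integral_nonneg fun _ => by positivity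

namespace NoisyRun

variable {Pr : Measure Ω} [IsProbabilityMeasure Pr] {F : Fin K → Model d → ℝ} {ε : ℕ → ℝ} {G : ℕ}
  {ψ : Fin K → ℝ} {ϱ L μ : ℝ} {U W : ℕ → Ω → Fin K → Model d} {n m : ℕ → Fin K → Ω → Model d}

theorem memLp_copies (h : NoisyRun Pr F ε G ψ ϱ U W n m) (hF : ∀ k, SmoothWith L (F k)) (t : ℕ) :
    ∀ j, MemLp (fun ω => U t ω j) 2 Pr := by
  induction t with
  | zero => exact h.memLp_copies_zero
  | succ t ih =>
    intro j
    have h1 : ∀ j, MemLp (fun ω => U t ω j - ε t • (gradient (F j) (U t ω j) + n t j ω)) 2 Pr :=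
      fun j => MemLp.fun_sub (ih j) (MemLp.fun_const_smul
        (MemLp.fun_add ((hF j).memLp_gradient (ih j)) (h.centered_copies t j).memLp) _)
    simp_rw [h.copies_succ]
    by_cases hd : G ∣ t + 1
    · simp only [hd, if_true]
      exact memLp_averageModel h1
    · simp only [hd, if_false]
      exact h1 j

theorem memLp_local (h : NoisyRun Pr F ε G ψ ϱ U W n m) (hF : ∀ k, SmoothWith L (F k)) (t : ℕ)
    (j : Fin K) : MemLp (fun ω => W t ω j) 2 Pr := by
  induction t with
  | zero => exact h.memLp_local_zero j
  | succ t ih =>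
    simp_rw [h.local_succ]
    refine MemLp.fun_sub ih (MemLp.fun_const_smul (MemLp.fun_const_smul (MemLp.fun_add ?_ ?_) _) _)
    · exact (hF j).memLp_gradient (MemLp.fun_add (MemLp.fun_const_smul ih _)
        (MemLp.fun_const_smul (h.memLp_copies hF t j) _))
    · exact (h.centered_local t j).memLp

variable [NeZero K]

omit [IsProbabilityMeasure Pr] in
-- Synchronization preserves the average, so both branches of the update give the same formula.
theorem average_succ (h : NoisyRun Pr F ε G ψ ϱ U W n m) (t : ℕ) (ω : Ω) :
    averageModel (U (t + 1) ω) = averageModel (U t ω)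
      - ε t • (averageModel fun j => gradient (F j) (U t ω j))
      - ε t • averageModel fun j => n t j ω := by
  have h1 : averageModel (U (t + 1) ω)
      = averageModel fun j => U t ω j - ε t • (gradient (F j) (U t ω j) + n t j ω) := by
    rw [h.copies_succ]
    split_ifs
    · exact averageModel_const _
    · rfl
  rw [h1, averageModel_sub, averageModel_smul, averageModel_add, smul_add, sub_add_eq_sub_sub]

omit [IsProbabilityMeasure Pr] [NeZero K] in
theorem copyDrift_zero (h : NoisyRun Pr F ε G ψ ϱ U W n m) (j : Fin K) :
    copyDrift Pr U 0 j = 0 := by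
  refine integral_eq_zero_of_ae (.of_forall fun ω => ?_)
  simp [sub_eq_zero.2 (h.copies_zero ω j)]

omit [IsProbabilityMeasure Pr] in
theorem copyDrift_succ_of_dvd (h : NoisyRun Pr F ε G ψ ϱ U W n m) {t : ℕ} (ht : G ∣ t + 1)
    (j : Fin K) : copyDrift Pr U (t + 1) j = 0 := by
  simp [copyDrift, h.copies_succ, ht, averageModel_const]

omit [NeZero K] in
theorem memLp_copies_sub_average (h : NoisyRun Pr F ε G ψ ϱ U W n m)
    (hF : ∀ k, SmoothWith L (F k)) (t : ℕ) (j : Fin K) :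
    MemLp (fun ω => U t ω j - averageModel (U t ω)) 2 Pr :=
  MemLp.fun_sub (h.memLp_copies hF t j) (memLp_averageModel (h.memLp_copies hF t))

omit [NeZero K] in
theorem integral_mean_drift (h : NoisyRun Pr F ε G ψ ϱ U W n m)
    (hF : ∀ k, SmoothWith L (F k)) (t : ℕ) :
    ∫ ω, (K : ℝ)⁻¹ * ∑ j, ‖U t ω j - averageModel (U t ω)‖ ^ 2 ∂Pr
      = (K : ℝ)⁻¹ * ∑ j, copyDrift Pr U t j := by
  rw [integral_const_mul, integral_finsetSum _ fun j _ =>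
    integrable_norm_sq_of_memLp_two (h.memLp_copies_sub_average hF t j)]
  rfl

omit [NeZero K] in
theorem integrable_mean_drift (h : NoisyRun Pr F ε G ψ ϱ U W n m)
    (hF : ∀ k, SmoothWith L (F k)) (t : ℕ) :
    Integrable (fun ω => (K : ℝ)⁻¹ * ∑ j, ‖U t ω j - averageModel (U t ω)‖ ^ 2) Pr :=
  (integrable_finsetSum _ fun j _ =>
    integrable_norm_sq_of_memLp_two (h.memLp_copies_sub_average hF t j)).const_mul _

/-- The average is the best common centre, so it may be replaced by `c`, the exact global gradient
step from the old average. This `c` depends on the current state only: noise costs just `ϱ ^ 2`, and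
the gradient mismatch at the average is `ζ j`. -/
theorem mean_copyDrift_succ_le (h : NoisyRun Pr F ε G ψ ϱ U W n m) (hL : 0 < L)
    (hF : ∀ k, SmoothWith L (F k))
    (hconv : ∀ k x y, F k y + inner ℝ (gradient (F k) y) (x - y) ≤ F k x)
    {ζ : Fin K → ℝ} (hζ : ∀ k w, gradientGapSq F k w ≤ ζ k) (hG : 1 ≤ G) (t : ℕ)
    (hε : 0 ≤ ε t) (hεL : ε t * L ≤ 2) (ht : ¬ G ∣ t + 1) :
    (K : ℝ)⁻¹ * ∑ j, copyDrift Pr U (t + 1) j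
      ≤ (1 + 1 / (G : ℝ)) * ((K : ℝ)⁻¹ * ∑ j, copyDrift Pr U t j)
        + ε t ^ 2 * (2 * G * ((K : ℝ)⁻¹ * ∑ j, ζ j) + ϱ ^ 2) := by
  have hK : (0 : ℝ) < K := Nat.cast_pos.2 (NeZero.pos K)
  have hG' : (1 : ℝ) ≤ G := by exact_mod_cast hG
  have hFg := SmoothWith.globalLoss hF
  set c : (Fin K → Model d) → Model d :=
    fun u => averageModel u - ε t • gradient (globalLoss F) (averageModel u) with hc
  have hgm : ∀ j, Measurable (gradient (F j)) := fun j => (hF j).continuous_gradient.measurable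
  have hggm : Measurable (gradient (globalLoss F)) := hFg.continuous_gradient.measurable
  have hcm : Measurable c := by fun_prop
  have hU := h.memLp_copies hF t
  have hcL : MemLp (fun ω => c (U t ω)) 2 Pr :=
    MemLp.fun_sub (memLp_averageModel hU)
      (MemLp.fun_const_smul (hFg.memLp_gradient (memLp_averageModel hU)) _)
  have hbd : ∀ j, ∫ ω, ‖U (t + 1) ω j - c (U t ω)‖ ^ 2 ∂Pr
      ≤ (1 + 1 / (G : ℝ)) * copyDrift Pr U t j + ε t ^ 2 * (2 * G * ζ j + ϱ ^ 2) := by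
    intro j
    let φ : (Fin K → Model d) × (Fin K → Model d) → Model d :=
      fun p => p.1 j - ε t • gradient (F j) (p.1 j) - c p.1
    have hφ : Measurable φ := by fun_prop
    have hφL : MemLp (fun ω => φ (U t ω, W t ω)) 2 Pr :=
      MemLp.fun_sub (MemLp.fun_sub (hU j)
        (MemLp.fun_const_smul ((hF j).memLp_gradient (hU j)) _)) hcL
    have h1 : ∀ ω, U (t + 1) ω j - c (U t ω) = φ (U t ω, W t ω) - ε t • n t j ω := by
      intro ω
      simp only [h.copies_succ, if_neg ht, φ]
      module
    simp_rw [h1]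
    rw [(h.centered_copies t j).integral_norm_sub_smul_sq hφ hφL]
    have h2 : ∫ ω, ‖φ (U t ω, W t ω)‖ ^ 2 ∂Pr
        ≤ ∫ ω, ((1 + 1 / (G : ℝ)) * ‖U t ω j - averageModel (U t ω)‖ ^ 2
          + (1 + G) * (ε t ^ 2 * ζ j)) ∂Pr := by
      refine integral_mono (integrable_norm_sq_of_memLp_two hφL)
        (((integrable_norm_sq_of_memLp_two (h.memLp_copies_sub_average hF t j)).const_mul _).add
          (integrable_const _)) fun ω => ?_
      refine (norm_gradient_step_sub_sq_le hL (hF j) (hconv j) hε hεL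
        (by linarith : (0 : ℝ) < G) _ _ _).trans ?_
      gcongr
      exact hζ j _
    rw [integral_add ((integrable_norm_sq_of_memLp_two
      (h.memLp_copies_sub_average hF t j)).const_mul _) (integrable_const _),
      integral_const_mul] at h2
    simp only [integral_const, probReal_univ, smul_eq_mul, one_mul] at h2
    have hζ0 : 0 ≤ ζ j := (sq_nonneg _).trans (hζ j 0)
    have h3 : (1 + (G : ℝ)) * (ε t ^ 2 * ζ j) ≤ (G + G) * (ε t ^ 2 * ζ j) := by gcongr
    have h4 := mul_le_mul_of_nonneg_left (h.variance_copies_le t j) (sq_nonneg (ε t))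
    unfold copyDrift
    linarith
  calc (K : ℝ)⁻¹ * ∑ j, copyDrift Pr U (t + 1) j
      = ∫ ω, (K : ℝ)⁻¹ * ∑ j, ‖U (t + 1) ω j - averageModel (U (t + 1) ω)‖ ^ 2 ∂Pr :=
        (h.integral_mean_drift hF (t + 1)).symm
    _ ≤ ∫ ω, (K : ℝ)⁻¹ * ∑ j, ‖U (t + 1) ω j - c (U t ω)‖ ^ 2 ∂Pr := by
        refine integral_mono (h.integrable_mean_drift hF (t + 1)) ?_ fun ω =>
          mean_norm_sub_averageModel_sq_le _ _
        exact (integrable_finsetSum _ fun j _ => integrable_norm_sq_of_memLp_two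
          (MemLp.fun_sub (h.memLp_copies hF (t + 1) j) hcL)).const_mul _
    _ = (K : ℝ)⁻¹ * ∑ j, ∫ ω, ‖U (t + 1) ω j - c (U t ω)‖ ^ 2 ∂Pr := by
        rw [integral_const_mul, integral_finsetSum _ fun j _ =>
          integrable_norm_sq_of_memLp_two (MemLp.fun_sub (h.memLp_copies hF (t + 1) j) hcL)]
    _ ≤ (K : ℝ)⁻¹ * ∑ j, ((1 + 1 / (G : ℝ)) * copyDrift Pr U t j
          + ε t ^ 2 * (2 * G * ζ j + ϱ ^ 2)) := by
        gcongr with j _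
        exact hbd j
    _ = _ := by
        simp only [Finset.sum_add_distrib, ← Finset.mul_sum, Finset.sum_const, Finset.card_univ,
          Fintype.card_fin, nsmul_eq_mul]
        field_simp

/-- For a single device the centre cannot be replaced. The true average moves along the mean of the
local gradients, whose mismatch with device `k` splits into gradient diversity and mean drift; it
also carries its own noise, whence `4 * ϱ ^ 2`. -/
theorem copyDrift_succ_le (h : NoisyRun Pr F ε G ψ ϱ U W n m) (hL : 0 < L)
    (hF : ∀ k, SmoothWith L (F k))
    (hconv : ∀ k x y, F k y + inner ℝ (gradient (F k) y) (x - y) ≤ F k x)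
    {ζ : Fin K → ℝ} (hζ : ∀ k w, gradientGapSq F k w ≤ ζ k) (hG : 1 ≤ G) (t : ℕ)
    (hε : 0 ≤ ε t) (hεL : ε t * L ≤ 2) (ht : ¬ G ∣ t + 1) (k : Fin K) :
    copyDrift Pr U (t + 1) k
      ≤ (1 + 1 / (G : ℝ)) * copyDrift Pr U t k
        + ε t ^ 2 * (4 * G * ζ k + 4 * ϱ ^ 2
          + 4 * G * L ^ 2 * ((K : ℝ)⁻¹ * ∑ j, copyDrift Pr U t j)) := by
  have hG' : (1 : ℝ) ≤ G := by exact_mod_cast hG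
  have hU := h.memLp_copies hF t
  set b : (Fin K → Model d) → Model d := fun u => averageModel fun j => gradient (F j) (u j)
    with hb
  have hgm : ∀ j, Measurable (gradient (F j)) := fun j => (hF j).continuous_gradient.measurable
  have hbm : Measurable b := by fun_prop
  have hbL : MemLp (fun ω => b (U t ω)) 2 Pr :=
    memLp_averageModel fun j => (hF j).memLp_gradient (hU j)
  let φ : (Fin K → Model d) × (Fin K → Model d) → Model d :=
    fun p => p.1 k - ε t • gradient (F k) (p.1 k) - (averageModel p.1 - ε t • b p.1)
  have hφ : Measurable φ := by fun_prop
  have hφL : MemLp (fun ω => φ (U t ω, W t ω)) 2 Pr :=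
    MemLp.fun_sub (MemLp.fun_sub (hU k) (MemLp.fun_const_smul ((hF k).memLp_gradient (hU k)) _))
      (MemLp.fun_sub (memLp_averageModel hU) (MemLp.fun_const_smul hbL _))
  have hZ := (h.centered_copies t k).sub (CenteredGiven.averageModel (h.centered_copies t))
  have h1 : ∀ ω, U (t + 1) ω k - averageModel (U (t + 1) ω)
      = φ (U t ω, W t ω) - ε t • (n t k ω - averageModel fun j => n t j ω) := by
    intro ω
    rw [h.average_succ]
    simp only [h.copies_succ, if_neg ht, φ, hb]
    module
  have hvar : ∫ ω, ‖n t k ω - averageModel fun j => n t j ω‖ ^ 2 ∂Pr ≤ 4 * ϱ ^ 2 := by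
    have i1 := integrable_norm_sq_of_memLp_two (h.centered_copies t k).memLp
    have i2 := integrable_norm_sq_of_memLp_two
      (CenteredGiven.averageModel (h.centered_copies t)).memLp
    have h2 := integral_mono (integrable_norm_sq_of_memLp_two hZ.memLp)
      ((i1.const_mul 2).add (i2.const_mul 2)) fun ω => norm_sub_sq_le_two_mul _ _
    have h3 := integral_norm_averageModel_sq_le (fun j => (h.centered_copies t j).memLp)
      (h.variance_copies_le t)
    rw [integral_add' (i1.const_mul 2) (i2.const_mul 2), integral_const_mul,
      integral_const_mul] at h2
    have h4 := h.variance_copies_le t k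
    linarith
  have i1 := integrable_norm_sq_of_memLp_two (h.memLp_copies_sub_average hF t k)
  have i2 := h.integrable_mean_drift hF t
  have hdet : ∫ ω, ‖φ (U t ω, W t ω)‖ ^ 2 ∂Pr
      ≤ ∫ ω, ((1 + 1 / (G : ℝ)) * ‖U t ω k - averageModel (U t ω)‖ ^ 2
        + (4 * G * ε t ^ 2 * ζ k + 4 * G * ε t ^ 2 * L ^ 2
          * ((K : ℝ)⁻¹ * ∑ j, ‖U t ω j - averageModel (U t ω)‖ ^ 2))) ∂Pr := by
    refine integral_mono (integrable_norm_sq_of_memLp_two hφL)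
      ((i1.const_mul _).add ((integrable_const _).add (i2.const_mul _))) fun ω => ?_
    refine (norm_gradient_step_sub_sq_le hL (hF k) (hconv k) hε hεL
      (by linarith : (0 : ℝ) < G) _ _ _).trans ?_
    gcongr
    have h2 := norm_add_sq_le_two_mul
      (b (U t ω) - gradient (globalLoss F) (averageModel (U t ω)))
      (gradient (globalLoss F) (averageModel (U t ω)) - gradient (F k) (averageModel (U t ω)))
    rw [sub_add_sub_cancel] at h2
    have h3 := norm_averageModel_gradient_sub_sq_le hF (U t ω)
    have h4 := hζ k (averageModel (U t ω))
    unfold gradientGapSq at h4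
    set D := (K : ℝ)⁻¹ * ∑ j, ‖U t ω j - averageModel (U t ω)‖ ^ 2
    have h5 : ‖b (U t ω) - gradient (F k) (averageModel (U t ω))‖ ^ 2
        ≤ 2 * (L ^ 2 * D) + 2 * ζ k := by linarith
    calc (1 + (G : ℝ)) * (ε t ^ 2 * ‖b (U t ω) - gradient (F k) (averageModel (U t ω))‖ ^ 2)
        ≤ (G + G) * (ε t ^ 2 * (2 * (L ^ 2 * D) + 2 * ζ k)) := by gcongr
      _ = _ := by ring
  rw [integral_add (i1.const_mul _) ((integrable_const _).fun_add (i2.const_mul _)),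
    integral_add (integrable_const _) (i2.const_mul _), integral_const_mul, integral_const_mul,
    integral_const_mul, h.integral_mean_drift hF] at hdet
  simp only [integral_const, probReal_univ, smul_eq_mul, one_mul] at hdet
  have h2 := mul_le_mul_of_nonneg_left hvar (sq_nonneg (ε t))
  have h3 : copyDrift Pr U (t + 1) k = ∫ ω, ‖φ (U t ω, W t ω)‖ ^ 2 ∂Pr
      + ε t ^ 2 * ∫ ω, ‖n t k ω - averageModel fun j => n t j ω‖ ^ 2 ∂Pr := by
    unfold copyDrift
    simp_rw [h1]
    exact hZ.integral_norm_sub_smul_sq hφ hφL (ε t)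
  rw [h3]
  unfold copyDrift at hdet ⊢
  linarith

/-- The expectation of `coupled_step_le`. Noise adds at most `4 * ϱ ^ 2` from the personalized model
and `46 * κ * ϱ ^ 2` from the global one, each times `ε t ^ 2`. -/
theorem coupled_error_succ_le (h : NoisyRun Pr F ε G ψ ϱ U W n m) (hL : 0 < L) (hμ : 0 < μ)
    (hμL : μ ≤ L) (hF : ∀ k, SmoothWith L (F k)) (hc : ∀ k, StronglyConvexWith μ (F k))
    {κ : ℝ} (hκ : κ = L / μ) {k : Fin K} {x₀ y₀ : Model d} (hx₀ : gradient (F k) x₀ = 0)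
    (hy₀ : gradient (globalLoss F) y₀ = 0) (t : ℕ) (hε : 0 ≤ ε t) (hεL : ε t * L ≤ 1 / 8)
    (hψ : 7 / 8 ≤ ψ k) (hψ1 : ψ k ≤ 1) :
    (∫ ω, ‖ψ k • W (t + 1) ω k + (1 - ψ k) • averageModel (U (t + 1) ω) - x₀‖ ^ 2 ∂Pr)
      + 46 * κ * (1 - ψ k) ^ 2 * ∫ ω, ‖averageModel (U (t + 1) ω) - y₀‖ ^ 2 ∂Pr
      ≤ (1 - 5 / 16 * (μ * ε t)) *
          ((∫ ω, ‖ψ k • W t ω k + (1 - ψ k) • averageModel (U t ω) - x₀‖ ^ 2 ∂Pr)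
            + 46 * κ * (1 - ψ k) ^ 2 * ∫ ω, ‖averageModel (U t ω) - y₀‖ ^ 2 ∂Pr)
        + ε t * L * (1 - ψ k) ^ 2 * (3 * copyDrift Pr U t k
          + 172 * κ ^ 2 * ((K : ℝ)⁻¹ * ∑ j, copyDrift Pr U t j))
        + 50 * κ * (ε t ^ 2 * ϱ ^ 2) := by
  set θ := 1 - ψ k with hθ
  have hθ0 : 0 ≤ θ := by linarith
  have hθ1 : θ ≤ 1 := by linarith
  have hκ1 : 1 ≤ κ := by rw [hκ, one_le_div hμ]; exact hμL
  have hU := h.memLp_copies hF t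
  have hUa := memLp_averageModel hU
  have hW := h.memLp_local hF t k
  set b : (Fin K → Model d) → Model d := fun u => averageModel fun j => gradient (F j) (u j)
    with hb
  have hgm : ∀ j, Measurable (gradient (F j)) := fun j => (hF j).continuous_gradient.measurable
  have hbm : Measurable b := by fun_prop
  have hbL : MemLp (fun ω => b (U t ω)) 2 Pr :=
    memLp_averageModel fun j => (hF j).memLp_gradient (hU j)
  let v : (Fin K → Model d) × (Fin K → Model d) → Model d :=
    fun p => ψ k • p.2 k + θ • averageModel p.1
  let x : (Fin K → Model d) × (Fin K → Model d) → Model d := fun p => ψ k • p.2 k + θ • p.1 k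
  have hvm : Measurable v := by fun_prop
  have hxm : Measurable x := by fun_prop
  have hvL : MemLp (fun ω => v (U t ω, W t ω)) 2 Pr :=
    MemLp.fun_add (MemLp.fun_const_smul hW _) (MemLp.fun_const_smul hUa _)
  have hxL : MemLp (fun ω => x (U t ω, W t ω)) 2 Pr :=
    MemLp.fun_add (MemLp.fun_const_smul hW _) (MemLp.fun_const_smul (hU k) _)
  -- One factor `ψ k` comes from the local update, the other from the mixing. The square stays above
  -- `3 / 4` because `ψ k ≥ 7 / 8`.
  let φ : (Fin K → Model d) × (Fin K → Model d) → Model d := fun p =>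
    v p - ε t • (ψ k ^ 2 • gradient (F k) (x p) + θ • b p.1) - x₀
  let χ : (Fin K → Model d) × (Fin K → Model d) → Model d := fun p =>
    averageModel p.1 - ε t • b p.1 - y₀
  have hφ : Measurable φ := by fun_prop
  have hχ : Measurable χ := by fun_prop
  have hφL : MemLp (fun ω => φ (U t ω, W t ω)) 2 Pr :=
    MemLp.fun_sub (MemLp.fun_sub hvL (MemLp.fun_const_smul (MemLp.fun_add
      (MemLp.fun_const_smul ((hF k).memLp_gradient hxL) _) (MemLp.fun_const_smul hbL _)) _))
      (memLp_const x₀)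
  have hχL : MemLp (fun ω => χ (U t ω, W t ω)) 2 Pr :=
    MemLp.fun_sub (MemLp.fun_sub hUa (MemLp.fun_const_smul hbL _)) (memLp_const y₀)
  have hna := CenteredGiven.averageModel (h.centered_copies t)
  have hZ := ((h.centered_local t k).const_smul (ψ k ^ 2)).add (hna.const_smul θ)
  have hnv := integral_norm_averageModel_sq_le (fun j => (h.centered_copies t j).memLp)
    (h.variance_copies_le t)
  -- Local and global noise share a mini-batch, so they are combined by the parallelogram bound, not
  -- by orthogonality.
  have hZv : ∫ ω, ‖ψ k ^ 2 • m t k ω + θ • averageModel fun j => n t j ω‖ ^ 2 ∂Pr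
      ≤ 4 * ϱ ^ 2 := by
    have i1 := integrable_norm_sq_of_memLp_two (h.centered_local t k).memLp
    have i2 := integrable_norm_sq_of_memLp_two hna.memLp
    have h2 : ∫ ω, ‖ψ k ^ 2 • m t k ω + θ • averageModel fun j => n t j ω‖ ^ 2 ∂Pr
        ≤ ∫ ω, (2 * ‖m t k ω‖ ^ 2 + 2 * ‖averageModel fun j => n t j ω‖ ^ 2) ∂Pr := by
      refine integral_mono (integrable_norm_sq_of_memLp_two hZ.memLp)
        ((i1.const_mul 2).add (i2.const_mul 2)) fun ω =>
        (norm_add_sq_le_two_mul _ _).trans ?_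
      have hψ2 : ψ k ^ 2 ≤ 1 := pow_le_one₀ (by linarith) hψ1
      rw [norm_smul, norm_smul, Real.norm_of_nonneg hθ0, Real.norm_of_nonneg (sq_nonneg _)]
      have h3 : ψ k ^ 2 * ‖m t k ω‖ ≤ 1 * ‖m t k ω‖ := by gcongr
      have h4 : θ * ‖averageModel fun j => n t j ω‖ ≤ 1 * ‖averageModel fun j => n t j ω‖ := by
        gcongr
      rw [one_mul] at h3 h4
      gcongr
    rw [integral_add (i1.const_mul 2) (i2.const_mul 2), integral_const_mul,
      integral_const_mul] at h2
    have h4 := h.variance_local_le t k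
    linarith
  have e1 : ∀ ω, ψ k • W (t + 1) ω k + θ • averageModel (U (t + 1) ω) - x₀
      = φ (U t ω, W t ω) - ε t • (ψ k ^ 2 • m t k ω + θ • averageModel fun j => n t j ω) := by
    intro ω
    rw [h.average_succ, h.local_succ]
    simp only [φ, v, x, hb, ← hθ]
    module
  have e2 : ∀ ω, averageModel (U (t + 1) ω) - y₀
      = χ (U t ω, W t ω) - ε t • averageModel fun j => n t j ω := by
    intro ω
    rw [h.average_succ]
    simp only [χ, hb]
    abel
  simp_rw [e1, e2]
  rw [hZ.integral_norm_sub_smul_sq hφ hφL, hna.integral_norm_sub_smul_sq hχ hχL]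
  have iφ := integrable_norm_sq_of_memLp_two hφL
  have iχ := integrable_norm_sq_of_memLp_two hχL
  have iv : Integrable (fun ω => ‖v (U t ω, W t ω) - x₀‖ ^ 2) Pr :=
    integrable_norm_sq_of_memLp_two (MemLp.fun_sub hvL (memLp_const x₀))
  have iy : Integrable (fun ω => ‖averageModel (U t ω) - y₀‖ ^ 2) Pr :=
    integrable_norm_sq_of_memLp_two (MemLp.fun_sub hUa (memLp_const y₀))
  have ik := integrable_norm_sq_of_memLp_two (h.memLp_copies_sub_average hF t k)
  have iD := h.integrable_mean_drift hF t
  have hdet := integral_mono (iφ.add (iχ.const_mul (46 * κ * θ ^ 2)))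
    (((iv.add (iy.const_mul (46 * κ * θ ^ 2))).const_mul (1 - 5 / 16 * (μ * ε t))).add
      (((ik.const_mul 3).add (iD.const_mul (172 * κ ^ 2))).const_mul (ε t * L * θ ^ 2)))
    fun ω => coupled_step_le hL hμ hμL hF hc hκ hx₀ hy₀ hε hεL
      (by nlinarith : 3 / 4 ≤ ψ k ^ 2) (pow_le_one₀ (by linarith) hψ1) hθ0
      (v (U t ω, W t ω)) (x (U t ω, W t ω)) (U t ω) (by simp only [v, x]; module)
  rw [integral_add' iφ (iχ.const_mul _), integral_const_mul,
    integral_add' ((iv.add (iy.const_mul _)).const_mul _)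
      (((ik.const_mul _).add (iD.const_mul _)).const_mul _),
    integral_const_mul, integral_const_mul, integral_add' iv (iy.const_mul _),
    integral_add' (ik.const_mul _) (iD.const_mul _), integral_const_mul, integral_const_mul,
    integral_const_mul, h.integral_mean_drift hF] at hdet
  have h1 := mul_le_mul_of_nonneg_left hZv (sq_nonneg (ε t))
  have h2 : 46 * κ * θ ^ 2 * (ε t ^ 2 * ∫ ω, ‖averageModel fun j => n t j ω‖ ^ 2 ∂Pr)
      ≤ 46 * κ * 1 * (ε t ^ 2 * ϱ ^ 2) := by
    gcongr
    exact pow_le_one₀ hθ0 hθ1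
  have h3 : 4 * (ε t ^ 2 * ϱ ^ 2) ≤ 4 * κ * (ε t ^ 2 * ϱ ^ 2) := by
    gcongr
    linarith
  unfold copyDrift at hdet ⊢
  linarith

end NoisyRun

end Run

/-! ### Measurability and independence of the state; reduction to a noisy run. -/

section History

variable {d K : ℕ} {S : Fin K → Type v} [∀ k, MeasurableSpace (S k)]

/-- The state after `t` iterations is a measurable function of the initial models and of the
mini-batches of the first `t` iterations. -/
theorem exists_measurable_state_eq (ε : ℕ → ℝ) (G : ℕ) {g : ∀ k, Model d → S k → Model d}
    (hg : ∀ k, Measurable fun p : Model d × S k => g k p.1 p.2) (ψ : Fin K → ℝ) (t : ℕ) :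
    ∃ Φ : (Model d × (Fin K → Model d)) ×
        (∀ i : (Finset.univ ×ˢ Finset.range t : Finset (Fin K × ℕ)), S i.1.1) →
        (Fin K → Model d) × (Fin K → Model d),
      Measurable Φ ∧ ∀ (x : ∀ k, ℕ → S k) (w₀ : Model d) (v₀ : Fin K → Model d),
        (globalCopies ε G g x w₀ t, localModel ε G g ψ x w₀ v₀ t)
          = Φ ((w₀, v₀), fun i => x i.1.1 i.1.2) := by
  induction t with
  | zero =>
    refine ⟨fun p => (fun _ => p.1.1, p.1.2), by fun_prop, fun x w₀ v₀ => rfl⟩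
  | succ t ih =>
    obtain ⟨Φ, hΦ, hΦeq⟩ := ih
    -- One iteration as a function of the state and the current mini-batches alone.
    let step : ((Fin K → Model d) × (Fin K → Model d)) × (∀ k, S k) →
        (Fin K → Model d) × (Fin K → Model d) := fun q =>
      (if G ∣ t + 1 then fun _ => averageModel fun k => q.1.1 k - ε t • g k (q.1.1 k) (q.2 k)
        else fun k => q.1.1 k - ε t • g k (q.1.1 k) (q.2 k),
      fun k => q.1.2 k - ε t • ψ k • g k (ψ k • q.1.2 k + (1 - ψ k) • q.1.1 k) (q.2 k))
    have hy : ∀ k, Measurable fun q : ((Fin K → Model d) × (Fin K → Model d)) × (∀ k, S k) =>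
        q.1.1 k - ε t • g k (q.1.1 k) (q.2 k) := by
      intro k
      have h1 := (hg k).comp (g := fun p : Model d × S k => g k p.1 p.2)
        (f := fun q : ((Fin K → Model d) × (Fin K → Model d)) × (∀ k, S k) =>
          (q.1.1 k, q.2 k)) (by fun_prop)
      have h2 : Measurable fun q : ((Fin K → Model d) × (Fin K → Model d)) × (∀ k, S k) =>
        g k (q.1.1 k) (q.2 k) := h1
      fun_prop
    have hstep : Measurable step := by
      refine Measurable.prodMk ?_ (measurable_pi_lambda _ fun k => ?_)
      · by_cases hd : G ∣ t + 1
        · simp only [hd, if_true]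
          fun_prop
        · simp only [hd, if_false]
          fun_prop
      · have h1 := (hg k).comp (g := fun p : Model d × S k => g k p.1 p.2)
          (f := fun q : ((Fin K → Model d) × (Fin K → Model d)) × (∀ k, S k) =>
            (ψ k • q.1.2 k + (1 - ψ k) • q.1.1 k, q.2 k)) (by fun_prop)
        have h2 : Measurable fun q : ((Fin K → Model d) × (Fin K → Model d)) × (∀ k, S k) =>
          g k (ψ k • q.1.2 k + (1 - ψ k) • q.1.1 k) (q.2 k) := h1
        fun_prop
    have hmem : ∀ i ∈ (Finset.univ ×ˢ Finset.range t : Finset (Fin K × ℕ)),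
        i ∈ (Finset.univ ×ˢ Finset.range (t + 1) : Finset (Fin K × ℕ)) := fun i hi =>
      Finset.mem_product.2 ⟨Finset.mem_univ _,
        Finset.mem_range.2 ((Finset.mem_range.1 (Finset.mem_product.1 hi).2).trans t.lt_succ_self)⟩
    have hmem' : ∀ k : Fin K,
        (k, t) ∈ (Finset.univ ×ˢ Finset.range (t + 1) : Finset (Fin K × ℕ)) := fun k =>
      Finset.mem_product.2 ⟨Finset.mem_univ _, Finset.self_mem_range_succ t⟩
    refine ⟨fun p => step (Φ (p.1, fun i => p.2 ⟨i.1, hmem i.1 i.2⟩),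
      fun k => p.2 ⟨(k, t), hmem' k⟩), ?_, fun x w₀ v₀ => ?_⟩
    · refine hstep.comp (Measurable.prodMk (hΦ.comp (measurable_fst.prodMk ?_)) ?_)
      · exact measurable_pi_lambda _ fun i => (measurable_pi_apply _).comp measurable_snd
      · exact measurable_pi_lambda _ fun k =>
          (measurable_pi_apply (⟨(k, t), hmem' k⟩ :
            (Finset.univ ×ˢ Finset.range (t + 1) : Finset (Fin K × ℕ)))).comp measurable_snd
    · dsimp only
      rw [← hΦeq]
      rfl

variable {Ω : Type u} [MeasurableSpace Ω] {Pr : Measure Ω} [IsProbabilityMeasure Pr]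
  {ξ : ∀ k, ℕ → Ω → S k} {w₀ : Ω → Model d} {v₀ : Fin K → Ω → Model d}

theorem measurable_state (ε : ℕ → ℝ) (G : ℕ) {g : ∀ k, Model d → S k → Model d}
    (hg : ∀ k, Measurable fun p : Model d × S k => g k p.1 p.2) (ψ : Fin K → ℝ)
    (hξ : ∀ k t, Measurable (ξ k t)) (hw₀ : Measurable w₀) (hv₀ : ∀ k, Measurable (v₀ k))
    (t : ℕ) :
    Measurable fun ω => (globalCopies ε G g (fun j s => ξ j s ω) (w₀ ω) t,
      localModel ε G g ψ (fun j s => ξ j s ω) (w₀ ω) (fun j => v₀ j ω) t) := by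
  obtain ⟨Φ, hΦ, hΦeq⟩ := exists_measurable_state_eq ε G hg ψ t
  simp_rw [hΦeq]
  exact hΦ.comp ((hw₀.prodMk (measurable_pi_lambda _ hv₀)).prodMk
    (measurable_pi_lambda _ fun i => hξ _ _))

/-- The mini-batches of iteration `t` are independent of the state after `t` iterations. -/
theorem indepFun_state (ε : ℕ → ℝ) (G : ℕ) {g : ∀ k, Model d → S k → Model d}
    (hg : ∀ k, Measurable fun p : Model d × S k => g k p.1 p.2) (ψ : Fin K → ℝ)
    (hξ : ∀ k t, Measurable (ξ k t))
    (hind : iIndepFun (fun (i : Fin K × ℕ) => ξ i.1 i.2) Pr)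
    (hw₀ : Measurable w₀) (hv₀ : ∀ k, Measurable (v₀ k))
    (hinit : IndepFun (fun ω => (w₀ ω, fun k => v₀ k ω))
      (fun ω (i : Fin K × ℕ) => ξ i.1 i.2 ω) Pr) (t : ℕ) (k : Fin K) :
    IndepFun (fun ω => (globalCopies ε G g (fun j s => ξ j s ω) (w₀ ω) t,
      localModel ε G g ψ (fun j s => ξ j s ω) (w₀ ω) (fun j => v₀ j ω) t)) (ξ k t) Pr := by
  obtain ⟨Φ, hΦ, hΦeq⟩ := exists_measurable_state_eq ε G hg ψ t
  simp_rw [hΦeq]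
  -- Past and current mini-batches have disjoint indices; the initial models are independent of all
  -- of them jointly (`h2`). Both facts are needed to regroup.
  have h1 : IndepFun
      (fun ω (i : (Finset.univ ×ˢ Finset.range t : Finset (Fin K × ℕ))) => ξ i.1.1 i.1.2 ω)
      (ξ k t) Pr := by
    have hdisj : Disjoint (Finset.univ ×ˢ Finset.range t : Finset (Fin K × ℕ)) {(k, t)} := by
      simp
    exact (hind.indepFun_finset _ _ hdisj fun i => hξ i.1 i.2).comp measurable_id
      (measurable_pi_apply (⟨(k, t), Finset.mem_singleton_self _⟩ :
        ({(k, t)} : Finset (Fin K × ℕ))))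
  have h2 : IndepFun (fun ω => (w₀ ω, fun k => v₀ k ω))
      (fun ω => ((fun (i : (Finset.univ ×ˢ Finset.range t : Finset (Fin K × ℕ))) =>
        ξ i.1.1 i.1.2 ω), ξ k t ω)) Pr := by
    have hm : Measurable fun x : (∀ i : Fin K × ℕ, S i.1) =>
        ((fun (i : (Finset.univ ×ˢ Finset.range t : Finset (Fin K × ℕ))) => x i.1), x (k, t)) :=
      (measurable_pi_lambda _ fun i => measurable_pi_apply _).prodMk (measurable_pi_apply _)
    exact hinit.comp measurable_id hm
  exact (IndepFun.prodMk_left_of_prodMk_right (hw₀.prodMk (measurable_pi_lambda _ hv₀))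
    (measurable_pi_lambda _ fun i => hξ _ _) (hξ k t) h2 h1).comp hΦ measurable_id

/-- The federated iteration with stochastic gradients is a run with additive gradient noise. -/
theorem noisyRun_federated {L ϱ : ℝ} [NeZero K] (ε : ℕ → ℝ) (G : ℕ) {F : Fin K → Model d → ℝ}
    {P : ∀ k, Measure (S k)} [∀ k, IsProbabilityMeasure (P k)]
    {g : ∀ k, Model d → S k → Model d} (hF : ∀ k, SmoothWith L (F k))
    (hg : ∀ k, BoundedVarianceGradient (P k) ϱ (F k) (g k)) (ψ : Fin K → ℝ)
    (hξ : ∀ k t, Measurable (ξ k t)) (hmap : ∀ k t, Measure.map (ξ k t) Pr = P k)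
    (hind : iIndepFun (fun (i : Fin K × ℕ) => ξ i.1 i.2) Pr)
    (hw₀ : Measurable w₀) (hv₀ : ∀ k, Measurable (v₀ k))
    (hw₀L : MemLp w₀ 2 Pr) (hv₀L : ∀ k, MemLp (v₀ k) 2 Pr)
    (hinit : IndepFun (fun ω => (w₀ ω, fun k => v₀ k ω))
      (fun ω (i : Fin K × ℕ) => ξ i.1 i.2 ω) Pr) :
    ∃ n m, NoisyRun Pr F ε G ψ ϱ
      (fun t ω => globalCopies ε G g (fun j s => ξ j s ω) (w₀ ω) t)
      (fun t ω => localModel ε G g ψ (fun j s => ξ j s ω) (w₀ ω) (fun j => v₀ j ω) t) n m := by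
  have hgm : ∀ k, Measurable fun p : Model d × S k => g k p.1 p.2 := fun k => (hg k).measurable
  have hcop := fun t (j : Fin K) => (hg j).centeredGiven (hF j)
    (measurable_state ε G hgm ψ hξ hw₀ hv₀ t) (hξ j t) (hmap j t)
    (indepFun_state ε G hgm ψ hξ hind hw₀ hv₀ hinit t j) (x := fun p => p.1 j) (by fun_prop)
  have hloc := fun t (j : Fin K) => (hg j).centeredGiven (hF j)
    (measurable_state ε G hgm ψ hξ hw₀ hv₀ t) (hξ j t) (hmap j t)
    (indepFun_state ε G hgm ψ hξ hind hw₀ hv₀ hinit t j)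
    (x := fun p => ψ j • p.2 j + (1 - ψ j) • p.1 j) (by fun_prop)
  -- The noises, found by unification, are stochastic minus exact gradient, at the copy and at the
  -- mixed point respectively.
  refine ⟨_, _, fun _ => hw₀L, hv₀L, fun ω j => ?_, fun t ω => ?_, fun t ω j => ?_,
    fun t j => (hcop t j).1, fun t j => (hloc t j).1, fun t j => (hcop t j).2,
    fun t j => (hloc t j).2⟩
  · simp [globalCopies, averageModel_const]
  · simp [globalCopies]
  · simp [localModel]

end History

/-! ### Scalar recursions. -/

section Recursions

/-- Fewer than `G` growth steps separate `t` from the last reset, and `(1 + 1 / G) ^ (3 * G) ≤ e ^ 3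
< 21`. The cube leaves room for one factor from Young and two from the squared ratio of learning
rates. -/
theorem le_of_block_recursion {G : ℕ} (hG : 1 ≤ G) {B : ℝ} (hB : 0 ≤ B) {δ : ℕ → ℝ}
    (h0 : δ 0 = 0) (hsync : ∀ t, G ∣ t + 1 → δ (t + 1) = 0)
    (hstep : ∀ t, ¬ G ∣ t + 1 → δ (t + 1) ≤ (1 + 1 / (G : ℝ)) ^ 3 * (δ t + B)) (t : ℕ) :
    δ t ≤ 21 * G * B := by
  set q : ℝ := (1 + 1 / (G : ℝ)) ^ 3 with hq
  have hG' : (0 : ℝ) < G := by exact_mod_cast hG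
  have hq1 : 1 ≤ q := one_le_pow₀ (by simp)
  -- The residue `t % G` counts the steps since the last synchronization.
  have key : ∀ t, δ t ≤ q ^ (t % G) * (t % G : ℕ) * B := by
    intro t
    induction t with
    | zero => simp [h0]
    | succ t ih =>
      by_cases hd : G ∣ t + 1
      · rw [hsync t hd]
        positivity
      · have hlt := Nat.mod_lt t hG
        have hdm := Nat.div_add_mod t G
        have hne : t % G + 1 ≠ G := fun h => hd ⟨t / G + 1, by rw [mul_add, mul_one]; omega⟩
        have hmod : (t + 1) % G = t % G + 1 := by
          calc (t + 1) % G = (G * (t / G) + (t % G + 1)) % G := by rw [← add_assoc, hdm]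
            _ = (t % G + 1) % G := Nat.mul_add_mod _ _ _
            _ = t % G + 1 := Nat.mod_eq_of_lt (by omega)
        rw [hmod]
        push_cast
        have h1 : 1 ≤ q ^ (t % G) := one_le_pow₀ hq1
        calc δ (t + 1) ≤ q * (δ t + B) := hstep t hd
          _ ≤ q * (q ^ (t % G) * (t % G : ℕ) * B + q ^ (t % G) * B) := by
              gcongr
              exact le_mul_of_one_le_left hB h1
          _ = _ := by ring
  have hr : t % G ≤ G := (Nat.mod_lt t hG).le
  have hexp : q ^ (t % G) ≤ 21 := by
    have h1 : (1 + 1 / (G : ℝ)) ^ G ≤ Real.exp 1 := by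
      have : 1 + 1 / (G : ℝ) ≤ Real.exp (1 / G) := by
        rw [add_comm]; exact Real.add_one_le_exp _
      calc (1 + 1 / (G : ℝ)) ^ G ≤ Real.exp (1 / G) ^ G := by gcongr
        _ = Real.exp 1 := by
            rw [← Real.exp_nat_mul]
            congr 1
            field_simp
    calc q ^ (t % G) ≤ q ^ G := pow_le_pow_right₀ hq1 hr
      _ = ((1 + 1 / (G : ℝ)) ^ G) ^ 3 := by rw [hq, ← pow_mul, ← pow_mul, mul_comm]
      _ ≤ 2.7182818286 ^ 3 := by
          gcongr
          exact h1.trans Real.exp_one_lt_d9.le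
      _ ≤ 21 := by norm_num
  have hr' : ((t % G : ℕ) : ℝ) ≤ G := by exact_mod_cast hr
  refine (key t).trans ?_
  gcongr

/-- Each of the three terms is a supersolution for its own source. The contraction constant 5 beats
the exponents 3, 1 and 2 with room for the sources, so the initial error decays cubically. -/
theorem le_of_harmonic_recursion {a b₁ b₂ : ℝ} (ha : 128 ≤ a) (hb₁ : 0 ≤ b₁) (hb₂ : 0 ≤ b₂)
    {V : ℕ → ℝ} (hV0 : 0 ≤ V 0)
    (hV : ∀ t : ℕ, V (t + 1) ≤ (1 - 5 / (t + a)) * V t + b₁ / (t + a) ^ 2 + b₂ / (t + a) ^ 3)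
    (t : ℕ) : V t ≤ a ^ 3 * V 0 / (t + a) ^ 3 + b₁ / (t + a) + b₂ / (t + a) ^ 2 := by
  induction t with
  | zero =>
    have : a ^ 3 * V 0 / (((0 : ℕ) : ℝ) + a) ^ 3 = V 0 := by
      have : a ≠ 0 := by linarith
      simp only [Nat.cast_zero, zero_add]
      field_simp
    rw [this]
    have h1 : 0 ≤ b₁ / (((0 : ℕ) : ℝ) + a) := by positivity
    have h2 : 0 ≤ b₂ / (((0 : ℕ) : ℝ) + a) ^ 2 := by positivity
    linarith
  | succ t ih =>
    have hs : 128 ≤ (t : ℝ) + a := by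
      have : (0 : ℝ) ≤ t := t.cast_nonneg
      linarith
    have hs' : ((t + 1 : ℕ) : ℝ) + a = (t : ℝ) + a + 1 := by push_cast; ring
    rw [hs']
    have ht := hV t
    set s := (t : ℝ) + a
    have hs0 : 0 < s := by linarith
    have hfac : 0 ≤ 1 - 5 / s := by
      rw [sub_nonneg, div_le_one hs0]
      linarith
    have h1 : (1 - 5 / s) * (1 / s ^ 3) ≤ 1 / (s + 1) ^ 3 := by
      have : (1 - 5 / s) * (1 / s ^ 3) = (s - 5) / s ^ 4 := by field_simp
      rw [this, div_le_div_iff₀ (by positivity) (by positivity)]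
      have : (s - 5) * (s + 1) ^ 3 = s ^ 4 - 2 * s ^ 3 - 12 * s ^ 2 - 14 * s - 5 := by ring
      have : 0 ≤ s ^ 3 := by positivity
      nlinarith [sq_nonneg s]
    have h2 : (1 - 5 / s) * (1 / s) + 1 / s ^ 2 ≤ 1 / (s + 1) := by
      have : (1 - 5 / s) * (1 / s) + 1 / s ^ 2 = (s - 4) / s ^ 2 := by field_simp; ring
      rw [this, div_le_div_iff₀ (by positivity) (by positivity)]
      nlinarith
    have h3 : (1 - 5 / s) * (1 / s ^ 2) + 1 / s ^ 3 ≤ 1 / (s + 1) ^ 2 := by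
      have : (1 - 5 / s) * (1 / s ^ 2) + 1 / s ^ 3 = (s - 4) / s ^ 3 := by field_simp; ring
      rw [this, div_le_div_iff₀ (by positivity) (by positivity)]
      nlinarith [sq_nonneg s]
    have ha0 : 0 ≤ a ^ 3 * V 0 := by positivity
    calc V (t + 1) ≤ (1 - 5 / s) * V t + b₁ / s ^ 2 + b₂ / s ^ 3 := ht
      _ ≤ (1 - 5 / s) * (a ^ 3 * V 0 / s ^ 3 + b₁ / s + b₂ / s ^ 2)
          + b₁ / s ^ 2 + b₂ / s ^ 3 := by gcongr
      _ = a ^ 3 * V 0 * ((1 - 5 / s) * (1 / s ^ 3)) + b₁ * ((1 - 5 / s) * (1 / s) + 1 / s ^ 2)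
          + b₂ * ((1 - 5 / s) * (1 / s ^ 2) + 1 / s ^ 3) := by ring
      _ ≤ a ^ 3 * V 0 * (1 / (s + 1) ^ 3) + b₁ * (1 / (s + 1)) + b₂ * (1 / (s + 1) ^ 2) := by
          gcongr
      _ = _ := by ring

end Recursions

/-! ### Estimates for the learning rate. -/

section Rates

variable {a μ L κ : ℝ}

theorem learningRate_pos (hμ : 0 < μ) (ha : 0 < a) (t : ℕ) : 0 < learningRate μ a t := by
  unfold learningRate
  positivity

theorem mul_learningRate (hμ : 0 < μ) (t : ℕ) : μ * learningRate μ a t = 16 / (t + a) := by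
  unfold learningRate
  field_simp

theorem learningRate_mul_le (hμ : 0 < μ) (ha : 0 < a) (hκ : κ = L / μ) (hL : 0 < L) (t : ℕ) :
    learningRate μ a t * L ≤ 16 * κ / a := by
  have h : learningRate μ a t * L = 16 * κ / (t + a) := by
    rw [hκ, learningRate]
    field_simp
  rw [h]
  have hκ0 : 0 < κ := hκ ▸ div_pos hL hμ
  gcongr
  exact le_add_of_nonneg_left t.cast_nonneg

theorem learningRate_le_succ (hμ : 0 < μ) {r : ℝ} (hr : 0 < r) (ha : r ≤ a) (t : ℕ) :
    learningRate μ a t ≤ (1 + 1 / r) * learningRate μ a (t + 1) := by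
  unfold learningRate
  have ht : (0 : ℝ) ≤ t := t.cast_nonneg
  have ha0 : 0 < a := hr.trans_le ha
  push_cast
  have h1 : 16 / (μ * ((t : ℝ) + a))
      = (1 + 1 / ((t : ℝ) + a)) * (16 / (μ * ((t : ℝ) + 1 + a))) := by
    field_simp
    ring
  rw [h1]
  gcongr
  linarith

/-- The block recursion for quantities compared with the squared learning rate. -/
theorem le_of_drift_recursion (hμ : 0 < μ) {G : ℕ} (hG : 1 ≤ G) (ha : (G : ℝ) ≤ a) {B : ℝ}
    (hB : 0 ≤ B) {D : ℕ → ℝ} (hD : ∀ t, 0 ≤ D t) (h0 : D 0 = 0)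
    (hsync : ∀ t, G ∣ t + 1 → D (t + 1) = 0)
    (hstep : ∀ t, ¬ G ∣ t + 1 →
      D (t + 1) ≤ (1 + 1 / (G : ℝ)) * D t + learningRate μ a t ^ 2 * B) (t : ℕ) :
    D t ≤ 21 * G * B * learningRate μ a t ^ 2 := by
  have hG' : (0 : ℝ) < G := by exact_mod_cast hG
  have hε := learningRate_pos hμ (hG'.trans_le ha)
  -- Dividing by the squared learning rate makes the source constant; the changing denominator costs
  -- `(1 + 1 / G) ^ 2` per step.
  have h := le_of_block_recursion hG hB (δ := fun t => D t / learningRate μ a t ^ 2) (by simp [h0])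
    (fun t ht => by simp [hsync t ht]) (fun t ht => ?_) t
  · rwa [div_le_iff₀ (by have := hε t; positivity)] at h
  · have h1 := hε t
    have h2 := hε (t + 1)
    have h3 := learningRate_le_succ hμ hG' ha t
    have h4 := hD t
    rw [div_le_iff₀ (by positivity)]
    have h5 : D t + learningRate μ a t ^ 2 * B
        = (D t / learningRate μ a t ^ 2 + B) * learningRate μ a t ^ 2 := by
      field_simp
    calc D (t + 1) ≤ (1 + 1 / (G : ℝ)) * D t + 1 * (learningRate μ a t ^ 2 * B) := by
          rw [one_mul]; exact hstep t ht
      _ ≤ (1 + 1 / (G : ℝ)) * D t + (1 + 1 / (G : ℝ)) * (learningRate μ a t ^ 2 * B) := by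
          gcongr
          simp
      _ = (1 + 1 / (G : ℝ)) * ((D t / learningRate μ a t ^ 2 + B) * learningRate μ a t ^ 2) := by
          rw [← h5]; ring
      _ ≤ (1 + 1 / (G : ℝ)) * ((D t / learningRate μ a t ^ 2 + B) *
            ((1 + 1 / (G : ℝ)) * learningRate μ a (t + 1)) ^ 2) := by
          gcongr
      _ = _ := by ring

end Rates

/-! ### Drift bounds and the distance to the local minimizer. -/

section Final

variable {d K : ℕ} {Ω : Type*} [MeasurableSpace Ω] {Pr : Measure Ω} [IsProbabilityMeasure Pr]
  {F : Fin K → Model d → ℝ} {G : ℕ} {ψ : Fin K → ℝ} {ϱ L μ κ a : ℝ}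
  {U W : ℕ → Ω → Fin K → Model d} {n m : ℕ → Fin K → Ω → Model d} [NeZero K]

theorem NoisyRun.mean_copyDrift_le (h : NoisyRun Pr F (learningRate μ a) G ψ ϱ U W n m)
    (hL : 0 < L) (hμ : 0 < μ) (hF : ∀ k, SmoothWith L (F k))
    (hc : ∀ k, StronglyConvexWith μ (F k)) (hκ : κ = L / μ)
    {ζ : Fin K → ℝ} (hζ : ∀ k w, gradientGapSq F k w ≤ ζ k) (hG : 1 ≤ G) (haκ : 128 * κ ≤ a)
    (haG : (G : ℝ) ≤ a) (t : ℕ) :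
    (K : ℝ)⁻¹ * ∑ j, copyDrift Pr U t j
      ≤ 21 * G * (2 * G * ((K : ℝ)⁻¹ * ∑ j, ζ j) + ϱ ^ 2) * learningRate μ a t ^ 2 := by
  have hG' : (0 : ℝ) < G := by exact_mod_cast hG
  have ha : 0 < a := hG'.trans_le haG
  have hζ0 : ∀ k, 0 ≤ ζ k := fun k => (sq_nonneg _).trans (hζ k 0)
  have hζs : 0 ≤ ∑ j, ζ j := Finset.sum_nonneg fun j _ => hζ0 j
  refine le_of_drift_recursion hμ hG haG (D := fun t => (K : ℝ)⁻¹ * ∑ j, copyDrift Pr U t j)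
    (by positivity) (fun t => ?_) ?_ (fun t ht => ?_)
    (fun t ht => ?_) t
  · exact mul_nonneg (by positivity) (Finset.sum_nonneg fun j _ => copyDrift_nonneg _ _ _ _)
  · simp [h.copyDrift_zero]
  · simp [h.copyDrift_succ_of_dvd ht]
  · refine h.mean_copyDrift_succ_le hL hF (fun k => (hc k).le hμ.le) hζ hG t
      (learningRate_pos hμ ha t).le ?_ ht
    have h1 := learningRate_mul_le hμ ha hκ hL t
    have h2 : 16 * κ / a ≤ 1 / 8 := by
      rw [div_le_iff₀ ha]; linarith
    linarith

theorem NoisyRun.copyDrift_le (h : NoisyRun Pr F (learningRate μ a) G ψ ϱ U W n m)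
    (hL : 0 < L) (hμ : 0 < μ) (hF : ∀ k, SmoothWith L (F k))
    (hc : ∀ k, StronglyConvexWith μ (F k)) (hκ : κ = L / μ)
    {ζ : Fin K → ℝ} (hζ : ∀ k w, gradientGapSq F k w ≤ ζ k) (hG : 1 ≤ G) (haκ : 128 * κ ≤ a)
    (haG : (G : ℝ) ≤ a) (k : Fin K) (t : ℕ) :
    copyDrift Pr U t k
      ≤ 21 * G * (4 * G * ζ k + 4 * ϱ ^ 2
          + 21504 * κ ^ 2 * (2 * G * ((K : ℝ)⁻¹ * ∑ j, ζ j) + ϱ ^ 2))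
        * learningRate μ a t ^ 2 := by
  have hG' : (0 : ℝ) < G := by exact_mod_cast hG
  have ha : 0 < a := hG'.trans_le haG
  have hκ0 : 0 < κ := hκ ▸ div_pos hL hμ
  have hζ0 : ∀ k, 0 ≤ ζ k := fun k => (sq_nonneg _).trans (hζ k 0)
  have hζs : 0 ≤ ∑ j, ζ j := Finset.sum_nonneg fun j _ => hζ0 j
  have hζk := hζ0 k
  refine le_of_drift_recursion hμ hG haG (D := fun t => copyDrift Pr U t k) (by positivity)
    (fun t => copyDrift_nonneg _ _ _ _)
    (h.copyDrift_zero k) (fun t ht => h.copyDrift_succ_of_dvd ht k) (fun t ht => ?_) t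
  have hε := learningRate_pos hμ ha t
  have h1 := learningRate_mul_le hμ ha hκ hL t
  have h2 : 16 * κ / a ≤ 1 / 8 := by
    rw [div_le_iff₀ ha]; linarith
  refine (h.copyDrift_succ_le hL hF (fun k => (hc k).le hμ.le) hζ hG t hε.le (by linarith) ht
    k).trans ?_
  have h3 := h.mean_copyDrift_le hL hμ hF hc hκ hζ hG haκ haG t
  set B := 2 * G * ((K : ℝ)⁻¹ * ∑ j, ζ j) + ϱ ^ 2 with hB
  have hB0 : 0 ≤ B := by positivity
  -- Here `a ≥ G` cancels the factor `G ^ 2` from inserting the mean drift; `84 * 16 ^ 2 = 21504`.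
  have h4 : learningRate μ a t * L ≤ 16 * κ / G := h1.trans (by gcongr)
  have h5 : 4 * G * L ^ 2 * ((K : ℝ)⁻¹ * ∑ j, copyDrift Pr U t j) ≤ 21504 * κ ^ 2 * B := by
    calc 4 * G * L ^ 2 * ((K : ℝ)⁻¹ * ∑ j, copyDrift Pr U t j)
        ≤ 4 * G * L ^ 2 * (21 * G * B * learningRate μ a t ^ 2) := by gcongr
      _ = 84 * G ^ 2 * B * (learningRate μ a t * L) ^ 2 := by ring
      _ ≤ 84 * G ^ 2 * B * (16 * κ / G) ^ 2 := by gcongr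
      _ = 21504 * κ ^ 2 * B := by field_simp; ring
  gcongr

/-- The mean squared distance of the personalized model of device `k` to a point with vanishing
local gradient. -/
theorem NoisyRun.integral_norm_personalized_sub_sq_le
    (h : NoisyRun Pr F (learningRate μ a) G ψ ϱ U W n m)
    (hL : 0 < L) (hμ : 0 < μ) (hμL : μ ≤ L) (hF : ∀ k, SmoothWith L (F k))
    (hc : ∀ k, StronglyConvexWith μ (F k)) (hκ : κ = L / μ)
    {ζ : Fin K → ℝ} (hζ : ∀ k w, gradientGapSq F k w ≤ ζ k) (hG : 1 ≤ G) (haκ : 128 * κ ≤ a)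
    (haG : (G : ℝ) ≤ a) {k : Fin K} {x₀ y₀ : Model d} (hx₀ : gradient (F k) x₀ = 0)
    (hy₀ : gradient (globalLoss F) y₀ = 0) (hψ : 7 / 8 ≤ ψ k) (hψ1 : ψ k ≤ 1) (T : ℕ) :
    (∫ ω, ‖ψ k • W T ω k + (1 - ψ k) • averageModel (U T ω) - x₀‖ ^ 2 ∂Pr)
      ≤ a ^ 3 * (47 * κ *
          ((∫ ω, ‖ψ k • W 0 ω k + (1 - ψ k) • averageModel (U 0 ω) - x₀‖ ^ 2 ∂Pr)
            + ∫ ω, ‖averageModel (U 0 ω) - y₀‖ ^ 2 ∂Pr)) / (T + a) ^ 3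
        + 12800 * κ * ϱ ^ 2 / μ ^ 2 / (T + a)
        + 86016 * κ * (1 - ψ k) ^ 2 / μ ^ 2 * (G * (12 * G * ζ k + 12 * ϱ ^ 2
            + 64684 * κ ^ 2 * (2 * G * ((K : ℝ)⁻¹ * ∑ j, ζ j) + ϱ ^ 2))) / (T + a) ^ 2 := by
  have hG' : (0 : ℝ) < G := by exact_mod_cast hG
  have ha : 0 < a := hG'.trans_le haG
  have hκ1 : 1 ≤ κ := by rw [hκ, one_le_div hμ]; exact hμL
  have hζ0 : ∀ k, 0 ≤ ζ k := fun k => (sq_nonneg _).trans (hζ k 0)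
  have hζs : 0 ≤ ∑ j, ζ j := Finset.sum_nonneg fun j _ => hζ0 j
  have hζk := hζ0 k
  have hLκ : L = κ * μ := by rw [hκ]; field_simp
  have hθ : (1 - ψ k) ^ 2 ≤ 1 := pow_le_one₀ (by linarith) (by linarith)
  set E : ℕ → ℝ := fun t =>
    ∫ ω, ‖ψ k • W t ω k + (1 - ψ k) • averageModel (U t ω) - x₀‖ ^ 2 ∂Pr with hE
  set Q : ℕ → ℝ := fun t => ∫ ω, ‖averageModel (U t ω) - y₀‖ ^ 2 ∂Pr with hQ
  have hE0 : ∀ t, 0 ≤ E t := fun t => integral_nonneg fun ω => by positivity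
  have hQ0 : ∀ t, 0 ≤ Q t := fun t => integral_nonneg fun ω => by positivity
  set B := 2 * G * ((K : ℝ)⁻¹ * ∑ j, ζ j) + ϱ ^ 2 with hB
  have hB0 : 0 ≤ B := by positivity
  set A := G * (12 * G * ζ k + 12 * ϱ ^ 2 + 64684 * κ ^ 2 * B) with hA
  have hA0 : 0 ≤ A := by positivity
  -- Constants: `12800 = 50 * 16 ^ 2`, `86016 = 21 * 16 ^ 3`, and in `A` the factor `64684 = 3 *
  -- 21504 + 172`.
  have hrec : ∀ t : ℕ, E (t + 1) + 46 * κ * (1 - ψ k) ^ 2 * Q (t + 1)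
      ≤ (1 - 5 / (t + a)) * (E t + 46 * κ * (1 - ψ k) ^ 2 * Q t)
        + 12800 * κ * ϱ ^ 2 / μ ^ 2 / (t + a) ^ 2
        + 86016 * κ * (1 - ψ k) ^ 2 / μ ^ 2 * A / (t + a) ^ 3 := by
    intro t
    have hε := learningRate_pos hμ ha t
    have h1 := learningRate_mul_le hμ ha hκ hL t
    have h2 : 16 * κ / a ≤ 1 / 8 := by
      rw [div_le_iff₀ ha]; linarith
    have h3 := h.coupled_error_succ_le hL hμ hμL hF hc hκ hx₀ hy₀ t hε.le (h1.trans h2) hψ hψ1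
    have h4 := h.mean_copyDrift_le hL hμ hF hc hκ hζ hG haκ haG t
    have h5 := h.copyDrift_le hL hμ hF hc hκ hζ hG haκ haG k t
    have hs : (0 : ℝ) < t + a := by positivity
    rw [← hB] at h4 h5
    have e1 : 5 / 16 * (μ * learningRate μ a t) = 5 / (t + a) := by
      rw [mul_learningRate hμ]; ring
    have e2 : 50 * κ * (learningRate μ a t ^ 2 * ϱ ^ 2)
        = 12800 * κ * ϱ ^ 2 / μ ^ 2 / (t + a) ^ 2 := by
      unfold learningRate; field_simp; ring
    have e3 : learningRate μ a t * L * (1 - ψ k) ^ 2 * (3 * copyDrift Pr U t k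
          + 172 * κ ^ 2 * ((K : ℝ)⁻¹ * ∑ j, copyDrift Pr U t j))
        ≤ 86016 * κ * (1 - ψ k) ^ 2 / μ ^ 2 * A / (t + a) ^ 3 := by
      calc _ ≤ learningRate μ a t * L * (1 - ψ k) ^ 2 *
            (3 * (21 * G * (4 * G * ζ k + 4 * ϱ ^ 2 + 21504 * κ ^ 2 * B) * learningRate μ a t ^ 2)
            + 172 * κ ^ 2 * (21 * G * B * learningRate μ a t ^ 2)) := by gcongr
        _ = 21 * (learningRate μ a t) ^ 3 * L * (1 - ψ k) ^ 2 * A := by rw [hA]; ring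
        _ = _ := by
          rw [hLκ]; unfold learningRate; field_simp; ring
    rw [e1, e2] at h3
    linarith
  have hκ0 : 0 < κ := by linarith
  have hfin := le_of_harmonic_recursion (a := a) (b₁ := 12800 * κ * ϱ ^ 2 / μ ^ 2)
    (b₂ := 86016 * κ * (1 - ψ k) ^ 2 / μ ^ 2 * A)
    (V := fun t => E t + 46 * κ * (1 - ψ k) ^ 2 * Q t) (by linarith) (by positivity)
    (by positivity) (by have := hE0 0; have := hQ0 0; positivity) hrec T
  have hQT := hQ0 T
  have h1 : 0 ≤ 46 * κ * (1 - ψ k) ^ 2 * Q T := by positivity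
  have h2 : E 0 + 46 * κ * (1 - ψ k) ^ 2 * Q 0 ≤ 47 * κ * (E 0 + Q 0) := by
    have := hE0 0
    have := hQ0 0
    have : E 0 * 1 ≤ E 0 * κ := by gcongr
    have : κ * Q 0 * (1 - ψ k) ^ 2 ≤ κ * Q 0 * 1 := by gcongr
    have : 0 ≤ κ * Q 0 := by positivity
    have : 0 ≤ E 0 * κ := by positivity
    linarith
  have h3 : a ^ 3 * (E 0 + 46 * κ * (1 - ψ k) ^ 2 * Q 0) / (T + a) ^ 3
      ≤ a ^ 3 * (47 * κ * (E 0 + Q 0)) / (T + a) ^ 3 := by gcongr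
  change E T ≤ a ^ 3 * (47 * κ * (E 0 + Q 0)) / (T + a) ^ 3 + _ + _
  linarith

end Final

/-! ### From squared distance to loss, and the theorem. -/

/-- The mixing weights of the federated algorithm are close to one. -/
theorem seven_eighths_le_of_mixing_weight {κ r ψ : ℝ} (hκ : 1 ≤ κ)
    (h : max (1 - 1 / (4 * √6 * κ)) r ≤ ψ) : 7 / 8 ≤ ψ := by
  have h6 : (2 : ℝ) ≤ √6 := Real.le_sqrt_of_sq_le (by norm_num)
  have h8 : 8 ≤ 4 * √6 * κ := by nlinarith
  have : 1 / (4 * √6 * κ) ≤ 1 / 8 := one_div_le_one_div_of_le (by norm_num) h8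
  linarith [le_max_left (1 - 1 / (4 * √6 * κ)) r]

/-- The bound on the mean squared distance implies the bound on the loss. -/
theorem half_mul_error_bound_le {L μ κ a ϱ ψ R z ζsum G K T : ℝ} (hL : 0 < L) (hμ : 0 < μ)
    (hκ : κ = L / μ) (ha0 : 0 < a) (hR0 : 0 ≤ R) (hz : 0 ≤ z) (hζs : 0 ≤ ζsum) (hG' : 0 < G)
    (hK : 0 < K) (hT0 : 0 < T) (hψ78 : 7 / 8 ≤ ψ) :
    L / 2 * (a ^ 3 * (47 * κ * R) / (T + a) ^ 3 + 12800 * κ * ϱ ^ 2 / μ ^ 2 / (T + a)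
        + 86016 * κ * (1 - ψ) ^ 2 / μ ^ 2 * (G * (12 * G * z + 12 * ϱ ^ 2
            + 64684 * κ ^ 2 * (2 * G * (K⁻¹ * ζsum) + ϱ ^ 2))) / (T + a) ^ 2)
      ≤ 10000 * κ ^ 2 * (a ^ 3 * R) * (μ / T ^ 3) + ψ ^ 2 * (10000 * κ ^ 2 * (ϱ ^ 2 / (μ * T)))
        + (1 - ψ) ^ 2 *
        (3 * 10 ^ 9 * (κ ^ 2 * G * (ϱ ^ 2 + G * (z + ζsum / K)) / (μ * T ^ 2)
          + κ ^ 4 * G * (ϱ ^ 2 + 2 * G * (ζsum / K)) / (μ * T ^ 2))) := by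
  have hκ0 : 0 < κ := hκ ▸ div_pos hL hμ
  have hLκ : L = κ * μ := by rw [hκ]; field_simp
  have hTa : T ≤ T + a := by linarith
  set B := 2 * G * (K⁻¹ * ζsum) + ϱ ^ 2 with hB
  have hB0 : 0 ≤ B := by positivity
  set A := G * (12 * G * z + 12 * ϱ ^ 2 + 64684 * κ ^ 2 * B) with hA
  have hA0 : 0 ≤ A := by positivity
  have e1 : L / 2 * (a ^ 3 * (47 * κ * R) / (T + a) ^ 3)
      ≤ 10000 * κ ^ 2 * (a ^ 3 * R) * (μ / T ^ 3) := by
    calc _ ≤ L / 2 * (a ^ 3 * (47 * κ * R) / T ^ 3) := by gcongr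
      _ = 47 / 2 * (κ ^ 2 * (a ^ 3 * R) * (μ / T ^ 3)) := by rw [hLκ]; ring
      _ ≤ 10000 * (κ ^ 2 * (a ^ 3 * R) * (μ / T ^ 3)) := by gcongr; norm_num
      _ = _ := by ring
  -- All noise of order `1 / T` is charged to the `ψ ^ 2` term, which is possible because `(7 / 8) ^
  -- 2 ≥ 16 / 25`.
  have e2 : L / 2 * (12800 * κ * ϱ ^ 2 / μ ^ 2 / (T + a))
      ≤ ψ ^ 2 * (10000 * κ ^ 2 * (ϱ ^ 2 / (μ * T))) := by
    calc _ ≤ L / 2 * (12800 * κ * ϱ ^ 2 / μ ^ 2 / T) := by gcongr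
      _ = 16 / 25 * (10000 * κ ^ 2 * (ϱ ^ 2 / (μ * T))) := by rw [hLκ]; field_simp; ring
      _ ≤ ψ ^ 2 * (10000 * κ ^ 2 * (ϱ ^ 2 / (μ * T))) := by gcongr; nlinarith
  have e3 : L / 2 * (86016 * κ * (1 - ψ) ^ 2 / μ ^ 2 * A / (T + a) ^ 2)
      ≤ (1 - ψ) ^ 2 *
        (3 * 10 ^ 9 * (κ ^ 2 * G * (ϱ ^ 2 + G * (z + ζsum / K)) / (μ * T ^ 2)
          + κ ^ 4 * G * (ϱ ^ 2 + 2 * G * (ζsum / K)) / (μ * T ^ 2))) := by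
    -- The absolute constant comes from `43008 * 64684 < 3 * 10 ^ 9`.
    have hA' : 43008 * (κ ^ 2 * A) ≤ 3 * 10 ^ 9 * (κ ^ 2 * G * (ϱ ^ 2 + G * (z + ζsum / K))
        + κ ^ 4 * G * (ϱ ^ 2 + 2 * G * (ζsum / K))) := by
      have p1 : 0 ≤ κ ^ 2 * G * (ϱ ^ 2 + G * z) := by positivity
      have p2 : 0 ≤ κ ^ 2 * G * (G * (ζsum / K)) := by positivity
      have p3 : 0 ≤ κ ^ 4 * G * (ϱ ^ 2 + 2 * G * (ζsum / K)) := by positivity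
      have e : 43008 * (κ ^ 2 * A) = 516096 * (κ ^ 2 * G * (ϱ ^ 2 + G * z))
          + 2781929472 * (κ ^ 4 * G * (ϱ ^ 2 + 2 * G * (ζsum / K))) := by
        rw [hA, hB]; ring
      rw [e]
      linarith
    calc _ ≤ L / 2 * (86016 * κ * (1 - ψ) ^ 2 / μ ^ 2 * A / T ^ 2) := by gcongr
      _ = (1 - ψ) ^ 2 * (43008 * (κ ^ 2 * A) / (μ * T ^ 2)) := by
          rw [hLκ]; field_simp; ring
      _ ≤ (1 - ψ) ^ 2 * (3 * 10 ^ 9 * (κ ^ 2 * G * (ϱ ^ 2 + G * (z + ζsum / K))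
        + κ ^ 4 * G * (ϱ ^ 2 + 2 * G * (ζsum / K))) / (μ * T ^ 2)) := by gcongr
      _ = _ := by ring
  rw [mul_add, mul_add]
  exact add_le_add (add_le_add e1 e2) e3

theorem theorem2 :
    -- `C` is absolute, `c` depends on the condition number only
    ∃ (C : ℝ) (c : ℝ → ℝ),
      ∀ (d K G : ℕ) (L μ ϱ κ a : ℝ), 1 ≤ G → 0 < L → 0 < μ → κ = L / μ → a = max (128 * κ) G →
      -- losses, their minimizers, stochastic gradients
      ∀ (F : Fin K → Model d → ℝ) (wopt : Fin K → Model d) (wgopt : Model d)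
        (S : Fin K → Type v) [∀ k, MeasurableSpace (S k)]
        (P : ∀ k, Measure (S k)) [∀ k, IsProbabilityMeasure (P k)]
        (g : ∀ k, Model d → S k → Model d),
      (∀ k, SmoothWith L (F k)) →
      (∀ k, BoundedVarianceGradient (P k) ϱ (F k) (g k)) →
      (∀ k, StronglyConvexWith μ (F k)) →
      (∀ k, BddAbove (Set.range (gradientGapSq F k))) →
      (∀ k, IsMinOn (F k) Set.univ (wopt k)) →
      IsMinOn (globalLoss F) Set.univ wgopt →
      -- independent mini-batches and random initial models independent of them
      ∀ (Ω : Type u) [MeasurableSpace Ω] (Pr : Measure Ω) [IsProbabilityMeasure Pr]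
        (ξ : ∀ k, ℕ → Ω → S k) (w₀ : Ω → Model d) (v₀ : Fin K → Ω → Model d),
      (∀ k t, Measurable (ξ k t)) →
      (∀ k t, Measure.map (ξ k t) Pr = P k) →
      iIndepFun (fun (i : Fin K × ℕ) => ξ i.1 i.2) Pr →
      Measurable w₀ → (∀ k, Measurable (v₀ k)) →
      MemLp w₀ 2 Pr → (∀ k, MemLp (v₀ k) 2 Pr) →
      IndepFun (fun ω => (w₀ ω, fun k => v₀ k ω)) (fun ω (i : Fin K × ℕ) => ξ i.1 i.2 ω) Pr →
      -- mixing weights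
      ∀ (ψ : Fin K → ℝ),
      (∀ k, max (1 - 1 / (4 * √6 * κ)) (1 - 1 / (4 * √6 * κ * √μ)) ≤ ψ k) →
      (∀ k, ψ k ≤ 1) →
      ∀ (what : ℕ → Fin K → Ω → Model d),
      (∀ t k ω, what t k ω = personalizedModel (learningRate μ a) G g ψ
        (fun j s => ξ j s ω) (w₀ ω) (fun j => v₀ j ω) t k) →
      ∀ (ζ : Fin K → ℝ) (ζsum : ℝ) (Δ R : Fin K → ℝ),
      (∀ k, ζ k = gradientDiversity F k) →
      ζsum = ∑ k, ζ k →
      (∀ k, Δ k = ‖wopt k - wgopt‖ ^ 2) →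
      (∀ k, R k = (∫ ω, ‖what 0 k ω - wopt k‖ ^ 2 ∂Pr) + ∫ ω, ‖w₀ ω - wgopt‖ ^ 2 ∂Pr) →
      ∀ (k : Fin K) (T : ℕ), 1 ≤ T →
        Integrable (fun ω => F k (what T k ω)) Pr ∧
        (∫ ω, F k (what T k ω) ∂Pr) - F k (wopt k) ≤
          c κ * (a ^ 3 * R k) * (μ / (T : ℝ) ^ 3)
          + ψ k ^ 2 * (c κ * (ϱ ^ 2 / (μ * T)))
          + (1 - ψ k) ^ 2 *
            (C * (ζ k / μ + κ * L * Δ k / 2)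
              + C * R k * (κ * L * Real.log T / (T : ℝ) ^ 3)
              + C * (κ ^ 2 * ϱ ^ 2 / (μ * K * T)))
          + (1 - ψ k) ^ 2 *
            (C * (κ ^ 2 * G * (ϱ ^ 2 + G * (ζ k + ζsum / K)) / (μ * (T : ℝ) ^ 2)
              + κ ^ 4 * G * (ϱ ^ 2 + 2 * G * (ζsum / K)) / (μ * (T : ℝ) ^ 2))) := by
  refine ⟨3 * 10 ^ 9, fun κ => 10000 * κ ^ 2, ?_⟩
  intro d K G L μ ϱ κ a hG hL hμ hκ ha F wopt wgopt S _ P _ g hF hg hc hbdd hopt hgopt Ω _ Pr _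
    ξ w₀ v₀ hξ hmap hind hw₀ hv₀ hw₀L hv₀L hinit ψ hψ hψ1 what hwhat ζ ζsum Δ R hζ hζsum hΔ hR k T hT
  have hKz : NeZero K := ⟨fun h => (h ▸ k).elim0⟩
  have hK : (0 : ℝ) < K := Nat.cast_pos.2 (NeZero.pos K)
  have hκ0 : 0 < κ := hκ ▸ div_pos hL hμ
  have hT' : (1 : ℝ) ≤ T := by exact_mod_cast hT
  have hT0 : (0 : ℝ) < T := by linarith
  have hG' : (0 : ℝ) < G := by exact_mod_cast hG
  have haκ : 128 * κ ≤ a := ha ▸ le_max_left _ _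
  have haG : (G : ℝ) ≤ a := ha ▸ le_max_right _ _
  have ha0 : 0 < a := hG'.trans_le haG
  have hlog : 0 ≤ Real.log T := Real.log_nonneg hT'
  have hgap : ∀ k w, gradientGapSq F k w ≤ ζ k := fun k w => by
    rw [hζ, gradientDiversity]
    exact le_ciSup (hbdd k) w
  have hζ0 : ∀ k, 0 ≤ ζ k := fun k => (sq_nonneg _).trans (hgap k 0)
  have hζk := hζ0 k
  have hζs : 0 ≤ ζsum := hζsum ▸ Finset.sum_nonneg fun j _ => hζ0 j
  have hΔ0 : 0 ≤ Δ k := by rw [hΔ]; positivity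
  have hR0 : 0 ≤ R k := by
    rw [hR]
    exact add_nonneg (integral_nonneg fun _ => by positivity)
      (integral_nonneg fun _ => by positivity)
  -- The bound already holds without this brace, which is added at the end.
  have hdrop : 0 ≤ 3 * 10 ^ 9 * (ζ k / μ + κ * L * Δ k / 2)
      + 3 * 10 ^ 9 * R k * (κ * L * Real.log T / (T : ℝ) ^ 3)
      + 3 * 10 ^ 9 * (κ ^ 2 * ϱ ^ 2 / (μ * K * T)) := by positivity
  have hdrop' := mul_nonneg (sq_nonneg (1 - ψ k)) hdrop
  -- In dimension zero `μ ≤ L` may fail, but all models coincide and the excess loss is zero.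
  rcases subsingleton_or_nontrivial (Model d) with hsub | hnt
  · have hconst : ∀ ω, F k (what T k ω) = F k (wopt k) := fun ω =>
      congrArg (F k) (Subsingleton.elim _ _)
    simp_rw [hconst]
    refine ⟨integrable_const _, ?_⟩
    rw [integral_const, probReal_univ, one_smul, sub_self]
    have h1 : 0 ≤ 10000 * κ ^ 2 * (a ^ 3 * R k) * (μ / (T : ℝ) ^ 3) := by positivity
    have h2 : 0 ≤ ψ k ^ 2 * (10000 * κ ^ 2 * (ϱ ^ 2 / (μ * T))) := by positivity
    have h3 : 0 ≤ (1 - ψ k) ^ 2 *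
        (3 * 10 ^ 9 * (κ ^ 2 * G * (ϱ ^ 2 + G * (ζ k + ζsum / K)) / (μ * (T : ℝ) ^ 2)
          + κ ^ 4 * G * (ϱ ^ 2 + 2 * G * (ζsum / K)) / (μ * (T : ℝ) ^ 2))) := by positivity
    exact add_nonneg (add_nonneg (add_nonneg h1 h2) hdrop') h3
  have hμL : μ ≤ L := (hc k).le_of_smoothWith (hF k)
  have hκ1 : 1 ≤ κ := by rw [hκ, one_le_div hμ]; exact hμL
  have hψ78 := seven_eighths_le_of_mixing_weight hκ1 (hψ k)
  have hx₀ := gradient_eq_zero_of_isMinOn (hopt k)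
  have hy₀ := gradient_eq_zero_of_isMinOn hgopt
  obtain ⟨n, m, hrun⟩ := noisyRun_federated (learningRate μ a) G hF hg ψ hξ hmap hind hw₀ hv₀
    hw₀L hv₀L hinit
  have hmain := hrun.integral_norm_personalized_sub_sq_le hL hμ hμL hF hc hκ hgap hG haκ haG hx₀
    hy₀ hψ78 (hψ1 k) T
  have hwhat' : ∀ t ω, what t k ω = ψ k • localModel (learningRate μ a) G g ψ
      (fun j s => ξ j s ω) (w₀ ω) (fun j => v₀ j ω) t k + (1 - ψ k) • averageModel
        (globalCopies (learningRate μ a) G g (fun j s => ξ j s ω) (w₀ ω) t) := fun t ω => hwhat t k ω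
  have hL2 : MemLp (what T k) 2 Pr := by
    rw [funext (hwhat' T)]
    exact MemLp.fun_add (MemLp.fun_const_smul (hrun.memLp_local hF T k) _)
      (MemLp.fun_const_smul (memLp_averageModel (hrun.memLp_copies hF T)) _)
  have hinit_avg : ∀ ω, averageModel
      (globalCopies (learningRate μ a) G g (fun j s => ξ j s ω) (w₀ ω) 0) = w₀ ω :=
    fun ω => averageModel_const _
  simp_rw [← hwhat', hinit_avg] at hmain
  rw [← hR k, ← hζsum] at hmain
  have hsq : Integrable (fun ω => ‖what T k ω - wopt k‖ ^ 2) Pr :=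
    integrable_norm_sq_of_memLp_two (MemLp.fun_sub hL2 (memLp_const _))
  have hupper : ∀ ω, F k (what T k ω) - F k (wopt k) ≤ L / 2 * ‖what T k ω - wopt k‖ ^ 2 := by
    intro ω
    have := (hF k).le_quadratic (wopt k) (what T k ω)
    rw [hx₀, inner_zero_left] at this
    linarith
  have hlower : ∀ ω, 0 ≤ F k (what T k ω) - F k (wopt k) := fun ω =>
    sub_nonneg.2 (hopt k (Set.mem_univ _))
  -- The excess loss lies between zero and an integrable quadratic.
  have hdiff : Integrable (fun ω => F k (what T k ω) - F k (wopt k)) Pr := by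
    refine (hsq.const_mul (L / 2)).mono'
      (((hF k).1.continuous.comp_aestronglyMeasurable hL2.1).sub aestronglyMeasurable_const)
      (.of_forall fun ω => ?_)
    rw [Real.norm_of_nonneg (hlower ω)]
    exact hupper ω
  have hint : Integrable (fun ω => F k (what T k ω)) Pr := by
    simpa using hdiff.fun_add (integrable_const (F k (wopt k)))
  refine ⟨hint, ?_⟩
  have hgapint : (∫ ω, F k (what T k ω) ∂Pr) - F k (wopt k)
      ≤ L / 2 * ∫ ω, ‖what T k ω - wopt k‖ ^ 2 ∂Pr := by
    have h1 := integral_mono hdiff (hsq.const_mul (L / 2)) hupper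
    rwa [integral_sub hint (integrable_const _), integral_const, probReal_univ, one_smul,
      integral_const_mul] at h1
  have hfin := hgapint.trans ((mul_le_mul_of_nonneg_left hmain (by positivity)).trans
    (half_mul_error_bound_le hL hμ hκ ha0 hR0 hζk hζs hG' hK hT0 hψ78))
  rw [add_right_comm]
  exact hfin.trans (le_add_of_nonneg_right hdrop')
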